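/- Let $n\ge 2$, let $\mathbb{S}^{2n-1}$ be the unit sphere of $\mathbb{C}^n$ with its surface measure and the CR structure induced from $\mathbb{C}^n$, and let $(0,1)$-forms carry the metric normalized by $\langle d\bar z_i,d\bar z_j\rangle=2\delta_{ij}$. On smooth functions put $$\bar\partial_b f=\sum_{i=1}^n\Big(\frac{\partial f}{\partial\bar z_i}-z_i\sum_{a=1}^n\bar z_a\frac{\partial f}{\partial\bar z_a}\Big)\,d\bar z_i,$$ let $\bar\partial_b: L^2(\mathbb{S}^{2n-1})\to L^2_{(0,1)}(\mathbb{S}^{2n-1})$ also denote its closure and $\bar\partial_b^{\ast}$ the Hilbert space adjoint, and let $\square_b=\bar\partial_b^{\ast}\bar\partial_b$ be the Kohn Laplacian on $L^2(\mathbb{S}^{2n-1})$, with its natural domain. For $m\in\mathbb{Z}$ let $N(m)$ be the number of positive eigenvalues $\lambda\le m$ of $\square_b$, counted with multiplicity (the dimension of the eigenspace). Then there is a real constant $c>0$, depending only on $n$, such that $$N(m)\le c\,m^n\quad\text{for all integers } m\ge 0,\qquad \tfrac1c\,m^n\le N(m)\quad\text{for all sufficiently large integers } m.$$ In particular $N(m)$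 is finite for every $m$ and $N(m)=\Theta(m^n)$ as $m\to\infty$. -/

import Mathlib

open MeasureTheory
open scoped ContDiff ENNReal

noncomputable section

namespace KohnSphere

/-- The composition `g ∘ f` of unbounded operators with its natural domain
`{x ∈ dom f : f x ∈ dom g}`. -/
def pcomp {E F G : Type*} [AddCommGroup E] [Module ℂ E] [AddCommGroup F] [Module ℂ F]
    [AddCommGroup G] [Module ℂ G] (g : F →ₗ.[ℂ] G) (f : E →ₗ.[ℂ] F) : E →ₗ.[ℂ] G :=
  g.comp (f.domRestrict ((g.domain.comap f.toFun).map f.domain.subtype)) (by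
    rintro ⟨_, ⟨y, hy, rfl⟩, -⟩
    exact hy)

theorem mem_pcomp_domain {E F G : Type*} [AddCommGroup E] [Module ℂ E] [AddCommGroup F]
    [Module ℂ F] [AddCommGroup G] [Module ℂ G] (g : F →ₗ.[ℂ] G) (f : E →ₗ.[ℂ] F) (x : E) :
    x ∈ (pcomp g f).domain ↔ ∃ h : x ∈ f.domain, f ⟨x, h⟩ ∈ g.domain := by
  constructor
  · rintro ⟨⟨y, hy, rfl⟩, -⟩
    exact ⟨y.2, hy⟩
  · rintro ⟨h, hx⟩
    exact ⟨⟨⟨x, h⟩, hx, rfl⟩, h⟩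

theorem pcomp_apply {E F G : Type*} [AddCommGroup E] [Module ℂ E] [AddCommGroup F]
    [Module ℂ F] [AddCommGroup G] [Module ℂ G] (g : F →ₗ.[ℂ] G) (f : E →ₗ.[ℂ] F)
    (x : (pcomp g f).domain) (h : (x : E) ∈ f.domain) (h' : f ⟨x, h⟩ ∈ g.domain) :
    pcomp g f x = g ⟨f ⟨x, h⟩, h'⟩ := rfl

/-- The eigenspace `{x ∈ dom T : T x = t x}` of an unbounded operator `T` (the zero space unless `t`
is an eigenvalue). -/
def eigenspace {E : Type*} [AddCommGroup E] [Module ℂ E] (T : E →ₗ.[ℂ] E) (t : ℝ) :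
    Submodule ℂ E :=
  (LinearMap.ker (T.toFun - (t : ℂ) • T.domain.subtype)).map T.domain.subtype

theorem mem_eigenspace {E : Type*} [AddCommGroup E] [Module ℂ E] (T : E →ₗ.[ℂ] E) (t : ℝ) (x : E) :
    x ∈ eigenspace T t ↔ ∃ h : x ∈ T.domain, T ⟨x, h⟩ = (t : ℂ) • x := by
  constructor
  · rintro ⟨y, hy, rfl⟩
    exact ⟨y.2, sub_eq_zero.mp hy⟩
  · rintro ⟨h, hx⟩
    exact ⟨⟨x, h⟩, sub_eq_zero.mpr hx, rfl⟩

/-- `ℂⁿ` with its Hermitian norm. -/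
abbrev Cn (n : ℕ) : Type := EuclideanSpace ℂ (Fin n)

/-- The unit sphere `S^{2n-1}` of `ℂⁿ`. -/
abbrev Sph (n : ℕ) : Type := Metric.sphere (0 : Cn n) 1

/-- The surface measure of `S^{2n-1}` induced by Lebesgue measure on `ℂⁿ = ℝ²ⁿ`. -/
abbrev surf (n : ℕ) : Measure (Sph n) := (volume : Measure (Cn n)).toSphere

/-- `L²(S^{2n-1})`. -/
abbrev L2 (n : ℕ) : Type := Lp ℂ 2 (surf n)

/-- The Wirtinger derivative `∂F/∂z̄ᵢ = (∂F/∂xᵢ + √-1 ∂F/∂yᵢ) / 2` at `z`. -/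
def wirtingerBar {n : ℕ} (F : Cn n → ℂ) (i : Fin n) (z : Cn n) : ℂ :=
  (1 / 2 : ℂ) * (fderiv ℝ F z (EuclideanSpace.single i 1)
    + Complex.I * fderiv ℝ F z (EuclideanSpace.single i Complex.I))

/-- The coefficient of `dz̄ᵢ` in `∂̄_b F`:  `∂F/∂z̄ᵢ - zᵢ ∑ₐ z̄ₐ ∂F/∂z̄ₐ`. -/
def dbarCoeff {n : ℕ} (F : Cn n → ℂ) (i : Fin n) (z : Cn n) : ℂ :=
  wirtingerBar F i z - z i * ∑ a, star (z a) * wirtingerBar F a z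

/-- The smooth complex-valued functions on `ℂⁿ` (smooth in the real sense). Their restrictions to
the sphere are exactly the smooth functions on the sphere. -/
def smoothFun (n : ℕ) : Submodule ℂ (Cn n → ℂ) where
  carrier := {F | ContDiff ℝ ∞ F}
  zero_mem' := Set.mem_ofPred_eq.mpr contDiff_const
  add_mem' hF hG := Set.mem_ofPred_eq.mpr
    (ContDiff.add (Set.mem_ofPred_eq.mp hF) (Set.mem_ofPred_eq.mp hG))
  smul_mem' c _ hF := Set.mem_ofPred_eq.mpr (ContDiff.const_smul c (Set.mem_ofPred_eq.mp hF))

theorem contDiff_coe {n : ℕ} (F : smoothFun n) : ContDiff ℝ ∞ (F : Cn n → ℂ) :=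
  Set.mem_ofPred_eq.mp F.2

theorem differentiableAt_coe {n : ℕ} (F : smoothFun n) (z : Cn n) :
    DifferentiableAt ℝ (F : Cn n → ℂ) z :=
  ((contDiff_coe F).differentiable (by simp)) z

/-- Restriction of smooth functions to the sphere. -/
def restrictC (n : ℕ) : smoothFun n →ₗ[ℂ] C(Sph n, ℂ) where
  toFun F := ⟨fun z => (F : Cn n → ℂ) z,
    (contDiff_coe F).continuous.comp continuous_subtype_val⟩
  map_add' _ _ := rfl
  map_smul' _ _ := rfl

theorem wirtingerBar_add {n : ℕ} (F G : smoothFun n) (i : Fin n) (z : Cn n) :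
    wirtingerBar ((F + G : smoothFun n) : Cn n → ℂ) i z
      = wirtingerBar (F : Cn n → ℂ) i z + wirtingerBar (G : Cn n → ℂ) i z := by
  have h : fderiv ℝ ((F + G : smoothFun n) : Cn n → ℂ) z
      = fderiv ℝ (F : Cn n → ℂ) z + fderiv ℝ (G : Cn n → ℂ) z :=
    fderiv_add (differentiableAt_coe F z) (differentiableAt_coe G z)
  simp only [wirtingerBar, h, add_apply]
  ring

theorem wirtingerBar_smul {n : ℕ} (c : ℂ) (F : smoothFun n) (i : Fin n) (z : Cn n) :
    wirtingerBar ((c • F : smoothFun n) : Cn n → ℂ) i z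
      = c * wirtingerBar (F : Cn n → ℂ) i z := by
  have h : fderiv ℝ ((c • F : smoothFun n) : Cn n → ℂ) z
      = c • fderiv ℝ (F : Cn n → ℂ) z :=
    fderiv_const_smul (differentiableAt_coe F z) c
  simp only [wirtingerBar, h, smul_apply, smul_eq_mul]
  ring

theorem continuous_dbarCoeff {n : ℕ} (F : smoothFun n) (i : Fin n) :
    Continuous (dbarCoeff (F : Cn n → ℂ) i) := by
  have h : Continuous (fderiv ℝ (F : Cn n → ℂ)) :=
    (contDiff_coe F).continuous_fderiv (by simp)
  unfold dbarCoeff wirtingerBar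
  fun_prop

/-- The coefficient vector of `∂̄_b F` on the sphere in the orthonormal coframe `dz̄ᵢ / √2`;
the metric is normalized by `⟨dz̄ᵢ, dz̄ⱼ⟩ = 2 δᵢⱼ`, so that `B dz̄ᵢ = (√2 B) (dz̄ᵢ / √2)`. -/
def dbarC (n : ℕ) : smoothFun n →ₗ[ℂ] C(Sph n, Cn n) where
  toFun F := ⟨fun z => WithLp.toLp 2 fun i => (Real.sqrt 2 : ℂ) * dbarCoeff (F : Cn n → ℂ) i z, by
    have h := fun i => (continuous_dbarCoeff F i).comp
      (continuous_subtype_val (p := fun z : Cn n => z ∈ Metric.sphere (0 : Cn n) 1))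
    refine (PiLp.continuous_toLp 2 _).comp (continuous_pi fun i => ?_)
    exact continuous_const.mul (h i)⟩
  map_add' F G := by
    ext z i
    simp only [dbarCoeff, wirtingerBar_add, ContinuousMap.coe_mk, ContinuousMap.add_apply,
      PiLp.add_apply, mul_add, Finset.sum_add_distrib]
    ring
  map_smul' c F := by
    ext z i
    simp only [dbarCoeff, wirtingerBar_smul, ContinuousMap.coe_mk, ContinuousMap.smul_apply,
      PiLp.smul_apply, smul_eq_mul, RingHom.id_apply, mul_left_comm _ c, ← Finset.mul_sum]
    ring

theorem sum_star_mul_self {n : ℕ} (z : Sph n) :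
    ∑ i, star ((z : Cn n) i) * (z : Cn n) i = 1 := by
  have h : ‖(z : Cn n)‖ ^ 2 = 1 := by
    have : ‖(z : Cn n)‖ = 1 := by simp
    rw [this]; norm_num
  rw [EuclideanSpace.norm_sq_eq] at h
  have h2 : ∀ i, star ((z : Cn n) i) * (z : Cn n) i = ((‖(z : Cn n) i‖ ^ 2 : ℝ) : ℂ) := by
    intro i
    rw [Complex.star_def, Complex.conj_mul']
    push_cast
    rfl
  simp_rw [h2]
  rw [← Complex.ofReal_sum, h, Complex.ofReal_one]

theorem sum_star_mul_dbarC {n : ℕ} (F : smoothFun n) (z : Sph n) :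
    ∑ i, star ((z : Cn n) i) * dbarC n F z i = 0 := by
  have h := sum_star_mul_self z
  simp only [dbarC, LinearMap.coe_mk, AddHom.coe_mk, ContinuousMap.coe_mk, dbarCoeff]
  set S := ∑ a, star ((z : Cn n) a) * wirtingerBar (F : Cn n → ℂ) a z with hS
  have h1 : ∀ i, star ((z : Cn n) i) *
      ((Real.sqrt 2 : ℂ) * (wirtingerBar (F : Cn n → ℂ) i z - (z : Cn n) i * S))
      = (Real.sqrt 2 : ℂ) * (star ((z : Cn n) i) * wirtingerBar (F : Cn n → ℂ) i z)
        - (Real.sqrt 2 : ℂ) * S * (star ((z : Cn n) i) * (z : Cn n) i) := by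
    intro i; ring
  simp_rw [h1]
  rw [Finset.sum_sub_distrib, ← Finset.mul_sum, ← Finset.mul_sum, h, ← hS]
  ring

/-- `L²_{(0,1)}(S^{2n-1})`: the square integrable `(0,1)`-forms `∑ Bᵢ dz̄ᵢ / √2` on the sphere,
i.e. those pointwise orthogonal to `∂̄|z|² = ∑ zᵢ dz̄ᵢ`. -/
def forms (n : ℕ) : Submodule ℂ (Lp (Cn n) 2 (surf n)) where
  carrier := {B | ∀ᵐ z : Sph n ∂(surf n), ∑ i, star ((z : Cn n) i) * B z i = 0}
  zero_mem' := by
    filter_upwards [Lp.coeFn_zero (Cn n) 2 (surf n)] with z hz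
    rw [hz]
    simp only [Pi.zero_apply, PiLp.zero_apply, mul_zero, Finset.sum_const_zero]
  add_mem' {A B} hA hB := by
    filter_upwards [hA, hB, Lp.coeFn_add A B] with z h1 h2 h3
    rw [h3]
    simp only [Pi.add_apply, PiLp.add_apply, mul_add, Finset.sum_add_distrib, h1, h2, add_zero]
  smul_mem' c A hA := by
    filter_upwards [hA, Lp.coeFn_smul c A] with z h1 h2
    simp only [h2, Pi.smul_apply, PiLp.smul_apply, smul_eq_mul, mul_left_comm _ c,
      ← Finset.mul_sum, h1, mul_zero]

/-- A smooth function, as an element of `L²(S^{2n-1})`. -/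
def toL2 (n : ℕ) : smoothFun n →ₗ[ℂ] L2 n :=
  (ContinuousMap.toLp 2 (surf n) ℂ : C(Sph n, ℂ) →L[ℂ] L2 n).toLinearMap ∘ₗ restrictC n

/-- `∂̄_b` of a smooth function, as an element of `L²_{(0,1)}(S^{2n-1})`. -/
def dbarL2 (n : ℕ) : smoothFun n →ₗ[ℂ] forms n :=
  LinearMap.codRestrict (forms n)
    ((ContinuousMap.toLp 2 (surf n) ℂ :
      C(Sph n, Cn n) →L[ℂ] Lp (Cn n) 2 (surf n)).toLinearMap ∘ₗ dbarC n)
    (fun F => by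
      change ∀ᵐ z : Sph n ∂(surf n), ∑ i, star ((z : Cn n) i) *
        (ContinuousMap.toLp 2 (surf n) ℂ (dbarC n F) : Lp (Cn n) 2 (surf n)) z i = 0
      filter_upwards [ContinuousMap.coeFn_toLp (p := 2) (𝕜 := ℂ) (surf n) (dbarC n F)] with z hz
      have := sum_star_mul_dbarC F z
      rw [hz]
      exact this)

/-- The derivative of a function vanishing on the sphere vanishes on tangent vectors. -/
theorem fderiv_tangent {n : ℕ} (F : smoothFun n) (hF : restrictC n F = 0) (z : Sph n) (v : Cn n)
    (hv : inner ℝ (z : Cn n) v = 0) : fderiv ℝ (F : Cn n → ℂ) z v = 0 := by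
  have hz : ‖(z : Cn n)‖ = 1 := by simp
  rcases eq_or_ne v 0 with rfl | hv0
  · simp
  have hn : ‖v‖ ≠ 0 := norm_ne_zero_iff.mpr hv0
  set w : Cn n := (‖v‖⁻¹ : ℝ) • v with hw
  have hwn : ‖w‖ = 1 := by rw [hw, norm_smul]; simp [hn]
  have hzw : inner ℝ (z : Cn n) w = 0 := by rw [hw, inner_smul_right, hv, mul_zero]
  let γ : ℝ → Cn n := fun t => Real.cos t • (z : Cn n) + Real.sin t • w
  have hγ : HasDerivAt γ w 0 := by
    have := ((Real.hasDerivAt_cos 0).smul_const (z : Cn n)).add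
      ((Real.hasDerivAt_sin 0).smul_const w)
    have e : -Real.sin 0 • (z : Cn n) + Real.cos 0 • w = w := by simp
    rw [e] at this
    exact this
  have hγ0 : γ 0 = z := by simp [γ]
  have hmem : ∀ t, (F : Cn n → ℂ) (γ t) = 0 := by
    intro t
    have hm : γ t ∈ Metric.sphere (0 : Cn n) 1 := by
      rw [mem_sphere_zero_iff_norm]
      have h2 : ‖γ t‖ ^ 2 = 1 := by
        have e := norm_add_sq_real (Real.cos t • (z : Cn n)) (Real.sin t • w)
        simp only [norm_smul, hz, hwn, inner_smul_left, inner_smul_right, hzw, mul_one, mul_zero,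
          Real.norm_eq_abs, sq_abs, add_zero] at e
        change ‖Real.cos t • (z : Cn n) + Real.sin t • w‖ ^ 2 = 1
        rw [e]
        exact Real.cos_sq_add_sin_sq t
      nlinarith [norm_nonneg (γ t)]
    exact DFunLike.congr_fun hF ⟨γ t, hm⟩
  have hd : HasDerivAt (fun t => (F : Cn n → ℂ) (γ t)) (fderiv ℝ (F : Cn n → ℂ) z w) 0 := by
    have := differentiableAt_coe F (γ 0)
    have h2 := this.hasFDerivAt.comp_hasDerivAt (0 : ℝ) hγ
    rwa [hγ0] at h2
  have h0 : fderiv ℝ (F : Cn n → ℂ) z w = 0 := by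
    have : (fun t => (F : Cn n → ℂ) (γ t)) = fun _ => 0 := funext hmem
    rw [this] at hd
    exact hd.unique (hasDerivAt_const _ _)
  have hvw : v = (‖v‖ : ℝ) • w := by rw [hw, smul_smul, mul_inv_cancel₀ hn, one_smul]
  rw [hvw, map_smul, h0, smul_zero]

/-- `∂̄_b F` on the sphere depends only on the values of `F` on the sphere. -/
theorem dbarC_eq_zero {n : ℕ} (F : smoothFun n) (hF : restrictC n F = 0) : dbarC n F = 0 := by
  ext z i
  have hz : ‖(z : Cn n)‖ = 1 := by simp
  set L : ℂ := fderiv ℝ (F : Cn n → ℂ) z z with hL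
  have key : ∀ v : Cn n, fderiv ℝ (F : Cn n → ℂ) z v = (inner ℝ (z : Cn n) v : ℝ) • L := by
    intro v
    have h := fderiv_tangent F hF z (v - (inner ℝ (z : Cn n) v : ℝ) • (z : Cn n)) (by
      rw [inner_sub_right, inner_smul_right, real_inner_self_eq_norm_sq, hz]; ring)
    rw [map_sub, map_smul, sub_eq_zero] at h
    exact h
  have hw : ∀ i, wirtingerBar (F : Cn n → ℂ) i z = (1 / 2 : ℂ) * L * (z : Cn n) i := by
    intro i
    have h1 : (inner ℝ (z : Cn n) (EuclideanSpace.single i (1 : ℂ)) : ℝ) = ((z : Cn n) i).re := by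
      rw [PiLp.inner_apply, Finset.sum_eq_single i]
      · simp [Complex.inner]
      · intro b _ hb
        simp [hb]
      · simp
    have h2 : (inner ℝ (z : Cn n) (EuclideanSpace.single i Complex.I) : ℝ)
        = ((z : Cn n) i).im := by
      rw [PiLp.inner_apply, Finset.sum_eq_single i]
      · simp [Complex.inner]
      · intro b _ hb
        simp [hb]
      · simp
    rw [wirtingerBar, key, key, h1, h2]
    simp only [Complex.real_smul]
    conv_rhs => rw [← Complex.re_add_im ((z : Cn n) i)]
    ring
  have hs := sum_star_mul_self z
  have h3 : ∑ a, star ((z : Cn n) a) * ((1 / 2 : ℂ) * L * (z : Cn n) a) = (1 / 2 : ℂ) * L := by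
    have : ∀ a, star ((z : Cn n) a) * ((1 / 2 : ℂ) * L * (z : Cn n) a)
        = (1 / 2 : ℂ) * L * (star ((z : Cn n) a) * (z : Cn n) a) := by intro a; ring
    simp_rw [this]
    rw [← Finset.mul_sum, hs, mul_one]
  have h4 : dbarCoeff (F : Cn n → ℂ) i z = 0 := by
    simp only [dbarCoeff, hw, h3]
    ring
  simp [dbarC, h4]

theorem ker_toL2_le (n : ℕ) : LinearMap.ker (toL2 n) ≤ LinearMap.ker (dbarL2 n) := by
  intro F hF
  have h1 : restrictC n F = 0 := by
    apply ContinuousMap.toLp_injective (p := 2) (𝕜 := ℂ) (surf n)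
    rw [map_zero]
    exact hF
  rw [LinearMap.mem_ker]
  apply Subtype.ext
  change (ContinuousMap.toLp 2 (surf n) ℂ : C(Sph n, Cn n) →L[ℂ] _) (dbarC n F) = 0
  rw [dbarC_eq_zero F h1, map_zero]

/-- `∂̄_b` on smooth functions, as an unbounded operator from `L²` to `L²_{(0,1)}`. -/
def dbarSmooth (n : ℕ) : L2 n →ₗ.[ℂ] forms n where
  domain := LinearMap.range (toL2 n)
  toFun := (LinearMap.ker (toL2 n)).liftQ (dbarL2 n) (ker_toL2_le n) ∘ₗ
    (toL2 n).quotKerEquivRange.symm.toLinearMap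

theorem dbarSmooth_apply {n : ℕ} (F : smoothFun n) :
    dbarSmooth n ⟨toL2 n F, LinearMap.mem_range_self _ F⟩ = dbarL2 n F := by
  change (LinearMap.ker (toL2 n)).liftQ (dbarL2 n) (ker_toL2_le n)
    ((toL2 n).quotKerEquivRange.symm ⟨toL2 n F, LinearMap.mem_range_self _ F⟩) = _
  rw [LinearMap.quotKerEquivRange_symm_apply_image, Submodule.mkQ_apply, Submodule.liftQ_apply]

/-- The closed, densely defined operator `∂̄_b : L² → L²_{(0,1)}`: the closure of `∂̄_b` on smooth
functions. -/
def dbarB (n : ℕ) : L2 n →ₗ.[ℂ] forms n := (dbarSmooth n).closure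

/-- The Hilbert space adjoint `∂̄_b^*`. -/
def dbarBStar (n : ℕ) : forms n →ₗ.[ℂ] L2 n := (dbarB n).adjoint

/-- The Kohn Laplacian on functions, `□_b = ∂̄_b^* ∂̄_b`, with its natural domain
`{f ∈ dom ∂̄_b : ∂̄_b f ∈ dom ∂̄_b^*}`. (On functions the term `∂̄_b ∂̄_b^*` vanishes.) -/
def kohnLaplacian (n : ℕ) : L2 n →ₗ.[ℂ] L2 n := pcomp (dbarBStar n) (dbarB n)

/-- The multiplicity of `t` as an eigenvalue of `□_b` (`0` if it is not an eigenvalue, `∞` if the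
eigenspace is infinite-dimensional). -/
def multiplicity (n : ℕ) (t : ℝ) : ℝ≥0∞ :=
  ((Cardinal.toENat (Module.rank ℂ (eigenspace (kohnLaplacian n) t)) : ℕ∞) : ℝ≥0∞)

/-- `N(m)`: the number of positive eigenvalues of `□_b` on `L²(S^{2n-1})` that are `≤ m`, counted
with multiplicity. -/
def eigenvalueCount (n : ℕ) (m : ℤ) : ℝ≥0∞ :=
  ∑' t : Set.Ioc (0 : ℝ) (m : ℝ), multiplicity n t

end KohnSphere

end

/-!
The Kohn Laplacian on the sphere is diagonalized by spherical harmonics of bidegree `(p, q)`, with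
eigenvalue `2 q (p + n - 1)`, and the eigenvalues are then counted.

*Integration by parts.* With the vector fields `L i j = zᵢ ∂̄ⱼ - zⱼ ∂̄ᵢ`, the pointwise inner
product of `∂̄_b F` and `∂̄_b G` is `∑ i, ∑ j, conj (L i j F) * L i j G` on the sphere (`inner_dbarL2`). The
conjugates of the `L i j` are complex combinations of infinitesimal rotations of `ℝ²ⁿ`, along which
derivatives integrate to zero because the surface measure is rotation invariant
(`integral_fderiv_skew`). So `∂̄_b P`, for a polynomial `P` in `z` and `z̄`, lies in the domain of
`∂̄_b^*`, and `□_b P` is the polynomial `-∑ conj (L i j) (L i j P)` (`kohnLaplacian_polyL2`).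

*Diagonalization.* For `P` of bidegree `(p, q)`, Euler's identity gives
`□_b P = 2 q (p + n - 1) P - 2 |z|² ∑ ∂ₐ ∂̄ₐ P` (`polyBox_bihom`). As `|z|² = 1` on the sphere,
`□_b` is triangular for the chain of bidegrees `(p, q)`, `(p - 1, q - 1)`, …; being symmetric, it is
scalar on the orthogonal complement of bidegree `(p - 1, q - 1)` in bidegree `(p, q)`
(`harmonics_le_eigenspace`). Polynomials are dense in `L²`, so every eigenspace for a positive
eigenvalue is spanned by these complements (`eigenspace_le_iSup`). No theory of harmonic
polynomials is needed.

*Counting.* A bihomogeneous polynomial is determined by its values on the sphere, so the dimension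
of the harmonics is a difference of products of binomial coefficients. The upper bound reduces to
`∑ (a + b) ≤ 4 m²` over the positive integers with `a b ≤ m` (`eigenvalueCount_le`), and the lower
bound already follows from the bidegrees `(p, 1)` (`pow_le_eigenvalueCount`).
-/

namespace KohnSphere

/-! ### Infinitesimal rotations of the sphere -/

section Rotation

variable {E : Type*} [NormedAddCommGroup E] [InnerProductSpace ℝ E]

/-- The action of a linear isometry on the unit sphere. -/
def sphereMap (U : E ≃ₗᵢ[ℝ] E) (z : Metric.sphere (0 : E) 1) : Metric.sphere (0 : E) 1 :=
  ⟨U z, by simp⟩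

theorem continuous_sphereMap (U : E ≃ₗᵢ[ℝ] E) : Continuous (sphereMap U) :=
  (U.continuous.comp continuous_subtype_val).subtype_mk _

variable [FiniteDimensional ℝ E] [MeasurableSpace E] [BorelSpace E]

open scoped Pointwise in
theorem measurePreserving_sphereMap (U : E ≃ₗᵢ[ℝ] E) :
    MeasurePreserving (sphereMap U) (volume : Measure E).toSphere
      (volume : Measure E).toSphere := by
  refine ⟨(continuous_sphereMap U).measurable, ?_⟩
  ext s hs
  have hm := (continuous_sphereMap U).measurable
  rw [Measure.map_apply hm hs, Measure.toSphere_apply' _ (hm hs), Measure.toSphere_apply' _ hs]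
  congr 1
  rw [← U.measurePreserving.measure_preimage_equiv (f := U.toMeasurableEquiv)
    (Set.Ioo (0 : ℝ) 1 • Subtype.val '' s)]
  congr 1
  ext x
  simp only [Set.mem_smul, Set.mem_image, Set.mem_preimage, Subtype.exists, exists_and_right,
    exists_eq_right]
  constructor
  · rintro ⟨r, hr, y, ⟨hy, hys⟩, rfl⟩
    exact ⟨r, hr, U y, ⟨(sphereMap U ⟨y, hy⟩).2, hys⟩, (U.map_smul r y).symm⟩
  · rintro ⟨r, hr, y, ⟨hy, hys⟩, h⟩
    refine ⟨r, hr, U.symm y, ⟨by simpa using hy, ?_⟩, ?_⟩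
    · convert hys
      simp [sphereMap]
    · rw [← U.symm.map_smul, h]
      exact U.symm_apply_apply x

/-- Infinitesimal rotation invariance of the surface measure: the derivative of a function along
a linear vector field tangent to the spheres integrates to zero. -/
theorem integral_fderiv_skew (A : E →L[ℝ] E) (hA : star A = -A) {H : E → ℂ}
    (hH : ContDiff ℝ 1 H) :
    ∫ z : Metric.sphere (0 : E) 1, fderiv ℝ H z (A z) ∂(volume : Measure E).toSphere = 0 := by
  let : NormedAlgebra ℚ (E →L[ℝ] E) := NormedAlgebra.restrictScalars ℚ ℝ (E →L[ℝ] E)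
  -- `t ↦ exp (tA)` is a one-parameter group of isometries, so `∫ H (exp (tA) z)` is constant in
  -- `t`; the claim is that its derivative at `t = 0` vanishes.
  have hU : ∀ t : ℝ, NormedSpace.exp (t • A) ∈ unitary (E →L[ℝ] E) := fun t =>
    NormedSpace.exp_mem_unitary_of_mem_skewAdjoint (by
      rw [skewAdjoint.mem_iff, star_smul, hA, star_trivial, smul_neg])
  set U : ℝ → E ≃ₗᵢ[ℝ] E := fun t => Unitary.linearIsometryEquiv ⟨_, hU t⟩
  have hUv : ∀ t x, U t x = NormedSpace.exp (t • A) x := fun t x => rfl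
  have hd : ∀ (x : E) (t : ℝ), HasDerivAt (fun t => U t x) (A (U t x)) t := by
    intro x t
    have h := (hasDerivAt_exp_smul_const' (𝕂 := ℝ) A t)
    have := h.clm_apply (hasDerivAt_const t x)
    simpa [hUv] using this
  have hdH : Continuous (fderiv ℝ H) := hH.continuous_fderiv (by simp)
  have hc : Continuous fun z : Metric.sphere (0 : E) 1 => fderiv ℝ H z (A z) := by fun_prop
  obtain ⟨C, hC⟩ := (isCompact_range hc).isBounded.exists_norm_le
  have hC' : ∀ z : Metric.sphere (0 : E) 1, ‖fderiv ℝ H z (A z)‖ ≤ C := fun z =>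
    hC _ ⟨z, rfl⟩
  have hcont : ∀ t, Continuous fun z : Metric.sphere (0 : E) 1 => H (U t z) := fun t =>
    hH.continuous.comp ((U t).continuous.comp continuous_subtype_val)
  have key := (hasDerivAt_integral_of_dominated_loc_of_deriv_le (𝕜 := ℝ) (x₀ := (0 : ℝ))
    (μ := (volume : Measure E).toSphere) (bound := fun _ => C) (s := Set.univ)
    (F := fun t (z : Metric.sphere (0 : E) 1) => H (U t z))
    (F' := fun t z => fderiv ℝ H (U t z) (A (U t z)))
    Filter.univ_mem (.of_forall fun t => (hcont t).aestronglyMeasurable)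
    ((hcont 0).integrable_of_hasCompactSupport (.of_compactSpace _))
    ?_ (.of_forall fun z t _ => hC' (sphereMap (U t) z)) (integrable_const _)
    (.of_forall fun z t _ =>
      ((hH.differentiable one_ne_zero _).hasFDerivAt.comp_hasDerivAt t (hd z t)))).2
  · have hconst : ∀ t, ∫ z : Metric.sphere (0 : E) 1, H (U t z) ∂(volume : Measure E).toSphere
        = ∫ z : Metric.sphere (0 : E) 1, H z ∂(volume : Measure E).toSphere := by
      intro t
      have hm := measurePreserving_sphereMap (U t)
      conv_rhs => rw [← hm.map_eq]
      exact (integral_map (f := fun z : Metric.sphere (0 : E) 1 => H z)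
        hm.measurable.aemeasurable
        (hH.continuous.comp continuous_subtype_val).aestronglyMeasurable).symm
    simp only [hconst] at key
    have h0 := key.unique (hasDerivAt_const _ _)
    simpa [hUv] using h0
  · have : Continuous fun z : Metric.sphere (0 : E) 1 =>
        fderiv ℝ H (U 0 z) (A (U 0 z)) := by simpa [hUv] using hc
    exact this.aestronglyMeasurable

end Rotation

/-! ### Wirtinger derivatives and tangential operators -/

variable {n : ℕ}

/-- The Wirtinger derivative `∂F/∂zᵢ` at `z`. -/
noncomputable def wirtinger (F : Cn n → ℂ) (i : Fin n) (z : Cn n) : ℂ :=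
  (1 / 2 : ℂ) * (fderiv ℝ F z (EuclideanSpace.single i 1)
    - Complex.I * fderiv ℝ F z (EuclideanSpace.single i Complex.I))

theorem fderiv_single (F : Cn n → ℂ) (j : Fin n) (z : Cn n) (c : ℂ) :
    fderiv ℝ F z (EuclideanSpace.single j c)
      = c * wirtinger F j z + star c * wirtingerBar F j z := by
  have h : (EuclideanSpace.single j c : Cn n)
      = c.re • EuclideanSpace.single j (1 : ℂ) + c.im • EuclideanSpace.single j Complex.I := by
    ext k
    by_cases hk : k = j
    · subst hk
      simp [Complex.re_add_im]
    · simp [hk]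
  have hc : star c = (c.re : ℂ) - c.im * Complex.I := by
    apply Complex.ext <;> simp
  rw [h, map_add, map_smul, map_smul, wirtinger, wirtingerBar, hc]
  conv_rhs => rw [← Complex.re_add_im c]
  simp only [Complex.real_smul, Complex.add_re, Complex.ofReal_re, Complex.mul_re, Complex.I_re,
    Complex.ofReal_im, Complex.I_im, Complex.add_im, Complex.mul_im]
  push_cast
  linear_combination ((c.im : ℂ) * fderiv ℝ F z (EuclideanSpace.single j Complex.I))
    * Complex.I_sq

theorem wirtinger_mul {F G : Cn n → ℂ} {z : Cn n} (hF : DifferentiableAt ℝ F z)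
    (hG : DifferentiableAt ℝ G z) (i : Fin n) :
    wirtinger (fun w => F w * G w) i z = wirtinger F i z * G z + F z * wirtinger G i z := by
  simp only [wirtinger, fderiv_fun_mul hF hG, add_apply, smul_apply, smul_eq_mul]
  ring

theorem wirtinger_star (F : Cn n → ℂ) (i : Fin n) (z : Cn n) :
    wirtinger (fun w => star (F w)) i z = star (wirtingerBar F i z) := by
  have h : ∀ v, fderiv ℝ (fun w => star (F w)) z v = star (fderiv ℝ F z v) := by
    intro v
    rw [fderiv_star]
    rfl
  simp only [wirtinger, wirtingerBar, h]
  simp only [star_mul', star_add, Complex.star_def, Complex.conj_I,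
    map_div₀, map_one, map_ofNat]
  ring

theorem inner_single_real (x : Cn n) (j : Fin n) (c : ℂ) :
    (inner ℝ x (EuclideanSpace.single j c) : ℝ) = (star (x j) * c).re := by
  rw [PiLp.inner_apply, Finset.sum_eq_single j]
  · simp [Complex.inner]
    ring
  · intro b _ hb
    simp [hb]
  · simp

/-- The infinitesimal rotation `z ↦ c (z̄ᵢ eⱼ - z̄ⱼ eᵢ)` of `ℂⁿ = ℝ²ⁿ`. -/
noncomputable def rotField (c : ℂ) (i j : Fin n) : Cn n →L[ℝ] Cn n :=
  LinearMap.toContinuousLinearMap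
    { toFun := fun z => EuclideanSpace.single j (c * star (z i))
        - EuclideanSpace.single i (c * star (z j))
      map_add' := fun x y => by
        simp only [PiLp.add_apply, star_add, mul_add, PiLp.single_add]
        abel
      map_smul' := fun r x => by
        ext k
        simp only [PiLp.smul_apply, star_smul, star_trivial, mul_smul_comm, PiLp.sub_apply,
          RingHom.id_apply, smul_sub, PiLp.single_apply]
        split_ifs <;> simp }

theorem rotField_apply (c : ℂ) (i j : Fin n) (z : Cn n) :
    rotField c i j z = EuclideanSpace.single j (c * star (z i))
        - EuclideanSpace.single i (c * star (z j)) := rfl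

theorem star_rotField (c : ℂ) (i j : Fin n) : star (rotField c i j) = -rotField c i j := by
  rw [ContinuousLinearMap.star_eq_adjoint, eq_comm, ContinuousLinearMap.eq_adjoint_iff]
  intro x y
  rw [neg_apply, inner_neg_left, real_inner_comm, rotField_apply, rotField_apply, inner_sub_right,
    inner_sub_right]
  simp only [inner_single_real]
  rw [← Complex.sub_re, ← Complex.sub_re, ← Complex.neg_re]
  congr 1
  ring

/-- Integration by parts for the tangential operators `z̄ᵢ ∂ⱼ - z̄ⱼ ∂ᵢ`. -/
theorem integral_tangential {H : Cn n → ℂ} (hH : ContDiff ℝ 1 H) (i j : Fin n) :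
    ∫ z : Sph n, (star ((z : Cn n) i) * wirtinger H j z - star ((z : Cn n) j) * wirtinger H i z)
      ∂(surf n) = 0 := by
  have h : ∀ z : Sph n, star ((z : Cn n) i) * wirtinger H j z
      - star ((z : Cn n) j) * wirtinger H i z
      = (1 / 2 : ℂ) * fderiv ℝ H z (rotField 1 i j z)
        - (Complex.I / 2) * fderiv ℝ H z (rotField Complex.I i j z) := by
    intro z
    simp only [rotField_apply, map_sub, fderiv_single, star_mul,
      Complex.star_def, Complex.conj_I, one_mul]
    ring_nf
    simp only [Complex.I_sq]
    ring
  have hi : ∀ c, Integrable (fun z : Sph n => fderiv ℝ H z (rotField c i j z)) (surf n) := by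
    intro c
    have hd : Continuous (fderiv ℝ H) := hH.continuous_fderiv (by simp)
    have hc : Continuous fun z : Sph n => fderiv ℝ H z (rotField c i j z) := by fun_prop
    exact hc.integrable_of_hasCompactSupport (.of_compactSpace _)
  simp_rw [h]
  rw [integral_sub ((hi 1).const_mul _) ((hi Complex.I).const_mul _), integral_const_mul,
    integral_const_mul, integral_fderiv_skew _ (star_rotField _ _ _) hH,
    integral_fderiv_skew _ (star_rotField _ _ _) hH]
  simp

/-- On the sphere, the pointwise inner product of `∂̄_b F` and `∂̄_b G` is a sum over the tangential
operators `zᵢ ∂̄ⱼ - zⱼ ∂̄ᵢ`. -/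
theorem sum_dbar_eq (z a b : Fin n → ℂ) (hz : ∑ i, star (z i) * z i = 1) :
    2 * ∑ k, star (a k - z k * ∑ l, star (z l) * a l) * (b k - z k * ∑ l, star (z l) * b l)
      = ∑ i, ∑ j, star (z i * a j - z j * a i) * (z i * b j - z j * b i) := by
  set A := ∑ l, star (z l) * a l with hA
  set B := ∑ l, star (z l) * b l with hB
  have hA' : ∑ l, z l * star (a l) = star A := by simp [hA, mul_comm]
  have hl : ∀ k, star (a k - z k * A) * (b k - z k * B)
      = star (a k) * b k - (z k * star (a k)) * B - star A * (star (z k) * b k)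
        + star A * B * (star (z k) * z k) := by
    intro k; simp only [star_sub, star_mul]; ring
  have hr : ∀ i j, star (z i * a j - z j * a i) * (z i * b j - z j * b i)
      = (star (z i) * z i) * (star (a j) * b j) + (star (a i) * b i) * (star (z j) * z j)
        - (star (z i) * b i) * (z j * star (a j))
        - (z i * star (a i)) * (star (z j) * b j) := by
    intro i j; simp only [star_sub, star_mul]; ring
  simp_rw [hl, hr, Finset.sum_add_distrib, Finset.sum_sub_distrib, Finset.sum_add_distrib,
    ← Finset.mul_sum, ← Finset.sum_mul, hz, hA', ← hB]
  ring

/-! ### Polynomials in `z` and `z̄` -/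

open MvPolynomial

/-- Polynomials in the variables `z₁, …, zₙ` (left summand) and `z̄₁, …, z̄ₙ` (right summand). -/
abbrev Poly (n : ℕ) : Type := MvPolynomial (Fin n ⊕ Fin n) ℂ

/-- The coordinate functions `zᵢ` and `z̄ᵢ`. -/
def coordFun : Fin n ⊕ Fin n → Cn n → ℂ :=
  Sum.elim (fun i z => z i) (fun i z => star (z i))

/-- The function `ℂⁿ → ℂ` defined by a polynomial in `z` and `z̄`. -/
noncomputable def evalFun (P : Poly n) (z : Cn n) : ℂ := eval (fun s => coordFun s z) P

theorem contDiff_coordFun (s : Fin n ⊕ Fin n) : ContDiff ℝ ∞ (coordFun (n := n) s) := by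
  have h : ∀ i : Fin n, ContDiff ℝ ∞ (fun z : Cn n => z i) := fun i =>
    ((EuclideanSpace.proj i : Cn n →L[ℂ] ℂ).restrictScalars ℝ).contDiff
  cases s with
  | inl i => exact h i
  | inr i => exact Complex.conjCLE.contDiff.comp (h i)

theorem contDiff_evalFun (P : Poly n) : ContDiff ℝ ∞ (evalFun P) := by
  induction P using MvPolynomial.induction_on with
  | C a =>
    have : evalFun (n := n) (C a) = fun _ => a := by funext z; simp [evalFun]
    rw [this]; exact contDiff_const
  | add p q hp hq =>
    have : evalFun (p + q) = fun z => evalFun p z + evalFun q z := by funext z; simp [evalFun]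
    rw [this]; exact hp.add hq
  | mul_X p s hp =>
    have : evalFun (p * X s) = fun z => evalFun p z * coordFun s z := by
      funext z; simp [evalFun]
    rw [this]; exact hp.mul (contDiff_coordFun s)

theorem differentiableAt_evalFun (P : Poly n) (z : Cn n) : DifferentiableAt ℝ (evalFun P) z :=
  (contDiff_evalFun P).differentiable (by simp) z

theorem fderiv_coordFun_inl (i : Fin n) (z v : Cn n) :
    fderiv ℝ (coordFun (Sum.inl i)) z v = v i :=
  DFunLike.congr_fun
    ((EuclideanSpace.proj i : Cn n →L[ℂ] ℂ).restrictScalars ℝ).fderiv v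

theorem fderiv_coordFun_inr (i : Fin n) (z v : Cn n) :
    fderiv ℝ (coordFun (Sum.inr i)) z v = star (v i) :=
  DFunLike.congr_fun
    ((Complex.conjCLE : ℂ →L[ℝ] ℂ).comp
      ((EuclideanSpace.proj i : Cn n →L[ℂ] ℂ).restrictScalars ℝ)).fderiv v

theorem fderiv_evalFun (P : Poly n) (z v : Cn n) :
    fderiv ℝ (evalFun P) z v
      = ∑ s, evalFun (pderiv s P) z * fderiv ℝ (coordFun s) z v := by
  induction P using MvPolynomial.induction_on with
  | C a =>
    have : evalFun (n := n) (C a) = fun _ => a := by funext z; simp [evalFun]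
    rw [this]
    simp [evalFun]
  | add p q hp hq =>
    have : evalFun (p + q) = fun z => evalFun p z + evalFun q z := by funext z; simp [evalFun]
    rw [this, fderiv_fun_add (differentiableAt_evalFun p z) (differentiableAt_evalFun q z),
      add_apply, hp, hq, ← Finset.sum_add_distrib]
    refine Finset.sum_congr rfl fun s _ => ?_
    simp only [evalFun, map_add]
    ring
  | mul_X p s hp =>
    have : evalFun (p * X s) = fun z => evalFun p z * coordFun s z := by
      funext z; simp [evalFun]
    rw [this, fderiv_fun_mul (differentiableAt_evalFun p z)
      ((contDiff_coordFun s).differentiable (by simp) z)]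
    simp only [add_apply, smul_apply, smul_eq_mul, hp, evalFun, Derivation.leibniz, pderiv_X,
      map_add, map_mul, eval_X, add_mul, Finset.sum_add_distrib, Finset.mul_sum]
    congr 1
    · rw [Finset.sum_eq_single s]
      · simp
      · intro b _ hb
        simp [hb.symm]
      · simp
    · refine Finset.sum_congr rfl fun t _ => ?_
      ring

theorem wirtingerBar_evalFun (P : Poly n) (i : Fin n) (z : Cn n) :
    wirtingerBar (evalFun P) i z = evalFun (pderiv (Sum.inr i) P) z := by
  simp only [wirtingerBar, fderiv_evalFun, Fintype.sum_sum_type, fderiv_coordFun_inl,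
    fderiv_coordFun_inr, PiLp.single_apply, mul_ite, mul_zero, apply_ite star, star_zero, star_one,
    Complex.star_def, Complex.conj_I, Finset.sum_ite_eq', Finset.mem_univ, if_true]
  linear_combination (1 / 2 * evalFun (pderiv (Sum.inl i) P) z
    - 1 / 2 * evalFun (pderiv (Sum.inr i) P) z) * Complex.I_sq

theorem wirtinger_evalFun (P : Poly n) (i : Fin n) (z : Cn n) :
    wirtinger (evalFun P) i z = evalFun (pderiv (Sum.inl i) P) z := by
  simp only [wirtinger, fderiv_evalFun, Fintype.sum_sum_type, fderiv_coordFun_inl,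
    fderiv_coordFun_inr, PiLp.single_apply, mul_ite, mul_zero, apply_ite star, star_zero, star_one,
    Complex.star_def, Complex.conj_I, Finset.sum_ite_eq', Finset.mem_univ, if_true]
  linear_combination (-1 / 2 * evalFun (pderiv (Sum.inl i) P) z
    + 1 / 2 * evalFun (pderiv (Sum.inr i) P) z) * Complex.I_sq

/-- The smooth function on `ℂⁿ` defined by a polynomial in `z` and `z̄`. -/
noncomputable def polySmooth (n : ℕ) : Poly n →ₗ[ℂ] smoothFun n where
  toFun P := ⟨evalFun P, Set.mem_ofPred_eq.mpr (contDiff_evalFun P)⟩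
  map_add' P Q := by
    apply Subtype.ext; funext z; simp [evalFun]
  map_smul' c P := by
    apply Subtype.ext; funext z; simp [evalFun]

theorem coe_polySmooth (P : Poly n) : (polySmooth n P : Cn n → ℂ) = evalFun P := rfl

/-- The restriction to the sphere of a polynomial in `z` and `z̄`, as an element of `L²`. -/
noncomputable def polyL2 (n : ℕ) : Poly n →ₗ[ℂ] L2 n := toL2 n ∘ₗ polySmooth n

/-! ### The weak Kohn Laplacian on polynomials -/

/-- The operator `zᵢ ∂̄ⱼ - zⱼ ∂̄ᵢ` on polynomials. -/
noncomputable def tangBar (i j : Fin n) (P : Poly n) : Poly n :=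
  X (Sum.inl i) * pderiv (Sum.inr j) P - X (Sum.inl j) * pderiv (Sum.inr i) P

/-- The operator `z̄ᵢ ∂ⱼ - z̄ⱼ ∂ᵢ` on polynomials. -/
noncomputable def tang (i j : Fin n) (P : Poly n) : Poly n :=
  X (Sum.inr i) * pderiv (Sum.inl j) P - X (Sum.inr j) * pderiv (Sum.inl i) P

/-- The Kohn Laplacian on polynomials, written as a sum over the tangential operators. The sum runs
over ordered pairs `(i, j)`, so each unordered pair occurs twice; this factor `2` is the one of the
normalization `⟨dz̄ᵢ, dz̄ⱼ⟩ = 2 δᵢⱼ`. -/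
noncomputable def polyBox (P : Poly n) : Poly n := -∑ i, ∑ j, tang i j (tangBar i j P)

/-- The adjoint of `zᵢ ∂̄ⱼ - zⱼ ∂̄ᵢ` on `L²` of the sphere is `-(z̄ᵢ ∂ⱼ - z̄ⱼ ∂ᵢ)`. -/
theorem integral_tangBar (G : smoothFun n) (Q : Poly n) (i j : Fin n) :
    ∫ z : Sph n, star ((z : Cn n) i * wirtingerBar (G : Cn n → ℂ) j z
        - (z : Cn n) j * wirtingerBar (G : Cn n → ℂ) i z) * evalFun Q z ∂(surf n)
      = -∫ z : Sph n, star ((G : Cn n → ℂ) z) * evalFun (tang i j Q) z ∂(surf n) := by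
  have hG := contDiff_coe G
  have hG' : ContDiff ℝ ∞ fun z => star ((G : Cn n → ℂ) z) := Complex.conjCLE.contDiff.comp hG
  have hH : ContDiff ℝ 1 fun z => evalFun Q z * star ((G : Cn n → ℂ) z) :=
    ((contDiff_evalFun Q).mul hG').of_le (by simp)
  have hdG : Continuous (fderiv ℝ (G : Cn n → ℂ)) := hG.continuous_fderiv (by simp)
  have hcQ : ∀ Q : Poly n, Continuous (evalFun Q) := fun Q => (contDiff_evalFun Q).continuous
  have hcG := hG.continuous
  have hcw : ∀ i, Continuous (wirtingerBar (G : Cn n → ℂ) i) := by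
    intro i
    unfold wirtingerBar
    fun_prop
  have key := integral_tangential hH i j
  have hint : ∀ f : Cn n → ℂ, Continuous f → Integrable (fun z : Sph n => f z) (surf n) :=
    fun f hf => (hf.comp continuous_subtype_val).integrable_of_hasCompactSupport
      (.of_compactSpace _)
  rw [eq_neg_iff_add_eq_zero, ← integral_add, ← key]
  · refine integral_congr_ae (.of_forall fun z => ?_)
    have hd : ∀ k, wirtinger (fun w => evalFun Q w * star ((G : Cn n → ℂ) w)) k z
        = evalFun (pderiv (Sum.inl k) Q) z * star ((G : Cn n → ℂ) z)
          + evalFun Q z * star (wirtingerBar (G : Cn n → ℂ) k z) := by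
      intro k
      rw [wirtinger_mul (differentiableAt_evalFun Q _) (hG'.differentiable (by simp) _),
        wirtinger_evalFun, wirtinger_star]
    simp only [hd]
    simp only [tang, evalFun, map_sub, map_mul, eval_X, coordFun, Sum.elim_inr, star_sub,
      star_mul']
    ring
  · refine hint (fun z => star (z i * wirtingerBar (G : Cn n → ℂ) j z
        - z j * wirtingerBar (G : Cn n → ℂ) i z) * evalFun Q z) ?_
    have := hcQ Q
    have := hcw i
    have := hcw j
    fun_prop
  · refine hint (fun z => star ((G : Cn n → ℂ) z) * evalFun (tang i j Q) z) ?_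
    have := hcQ (tang i j Q)
    fun_prop

theorem inner_toL2 (F G : smoothFun n) :
    inner ℂ (toL2 n F) (toL2 n G)
      = ∫ z : Sph n, star ((F : Cn n → ℂ) z) * (G : Cn n → ℂ) z ∂(surf n) := by
  rw [L2.inner_def]
  refine integral_congr_ae ?_
  have h : ∀ F : smoothFun n, (toL2 n F : Sph n → ℂ) =ᵐ[surf n] fun z => (F : Cn n → ℂ) z :=
    fun F => ContinuousMap.coeFn_toLp (p := 2) (𝕜 := ℂ) (surf n) (restrictC n F)
  filter_upwards [h F, h G] with z h1 h2
  rw [h1, h2]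
  simp [mul_comm]

/-- The inner product of `∂̄_b F` and `∂̄_b G` in terms of the tangential operators. The factor `2`
of the metric cancels the `1/2` coming from summing over ordered pairs. -/
theorem inner_dbarL2 (F G : smoothFun n) :
    inner ℂ (dbarL2 n F) (dbarL2 n G)
      = ∫ z : Sph n, ∑ i, ∑ j, star ((z : Cn n) i * wirtingerBar (F : Cn n → ℂ) j z
          - (z : Cn n) j * wirtingerBar (F : Cn n → ℂ) i z)
        * ((z : Cn n) i * wirtingerBar (G : Cn n → ℂ) j z
          - (z : Cn n) j * wirtingerBar (G : Cn n → ℂ) i z) ∂(surf n) := by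
  rw [Submodule.coe_inner, L2.inner_def]
  refine integral_congr_ae ?_
  have h : ∀ F : smoothFun n, ((dbarL2 n F : Lp (Cn n) 2 (surf n)) : Sph n → Cn n)
      =ᵐ[surf n] fun z => dbarC n F z :=
    fun F => ContinuousMap.coeFn_toLp (p := 2) (𝕜 := ℂ) (surf n) (dbarC n F)
  filter_upwards [h F, h G] with z h1 h2
  rw [h1, h2]
  rw [← sum_dbar_eq _ _ _ (sum_star_mul_self z), PiLp.inner_apply, Finset.mul_sum]
  refine Finset.sum_congr rfl fun k _ => ?_
  have h2 : (Real.sqrt 2 : ℂ) * (Real.sqrt 2 : ℂ) = 2 := by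
    rw [← Complex.ofReal_mul, Real.mul_self_sqrt (by norm_num)]
    norm_num
  simp only [dbarC, LinearMap.coe_mk, AddHom.coe_mk, ContinuousMap.coe_mk, dbarCoeff,
    RCLike.inner_apply, map_mul, Complex.conj_ofReal, Complex.star_def]
  rw [← h2]
  ring

/-- The weak form of `∂̄_b^* ∂̄_b P = □_b P` for a polynomial `P`. -/
theorem inner_dbarL2_polySmooth (G : smoothFun n) (P : Poly n) :
    inner ℂ (dbarL2 n G) (dbarL2 n (polySmooth n P))
      = inner ℂ (toL2 n G) (polyL2 n (polyBox P)) := by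
  have hG := contDiff_coe G
  have hdG : Continuous (fderiv ℝ (G : Cn n → ℂ)) := hG.continuous_fderiv (by simp)
  have hcQ : ∀ Q : Poly n, Continuous (evalFun Q) := fun Q => (contDiff_evalFun Q).continuous
  have hcG := hG.continuous
  have hcw : ∀ i, Continuous (wirtingerBar (G : Cn n → ℂ) i) := by
    intro i
    unfold wirtingerBar
    fun_prop
  have hint : ∀ f : Cn n → ℂ, Continuous f → Integrable (fun z : Sph n => f z) (surf n) :=
    fun f hf => (hf.comp continuous_subtype_val).integrable_of_hasCompactSupport
      (.of_compactSpace _)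
  have hi1 : ∀ i j, Integrable (fun z : Sph n =>
      star ((z : Cn n) i * wirtingerBar (G : Cn n → ℂ) j z
        - (z : Cn n) j * wirtingerBar (G : Cn n → ℂ) i z) * evalFun (tangBar i j P) z)
      (surf n) := by
    intro i j
    refine hint (fun z => star (z i * wirtingerBar (G : Cn n → ℂ) j z
        - z j * wirtingerBar (G : Cn n → ℂ) i z) * evalFun (tangBar i j P) z) ?_
    have := hcQ (tangBar i j P)
    have := hcw i
    have := hcw j
    fun_prop
  have hi2 : ∀ i j, Integrable (fun z : Sph n =>
      star ((G : Cn n → ℂ) z) * evalFun (tang i j (tangBar i j P)) z) (surf n) := by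
    intro i j
    refine hint (fun z => star ((G : Cn n → ℂ) z) * evalFun (tang i j (tangBar i j P)) z) ?_
    have := hcQ (tang i j (tangBar i j P))
    fun_prop
  have hL : ∀ (i j : Fin n) (z : Sph n), (z : Cn n) i * wirtingerBar (evalFun P) j z
      - (z : Cn n) j * wirtingerBar (evalFun P) i z = evalFun (tangBar i j P) z := by
    intro i j z
    simp [wirtingerBar_evalFun, tangBar, evalFun, coordFun]
  rw [inner_dbarL2, polyL2, LinearMap.comp_apply, inner_toL2]
  simp only [coe_polySmooth, hL]
  have hR : ∀ z : Sph n, star ((G : Cn n → ℂ) z) * evalFun (polyBox P) z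
      = -∑ i, ∑ j, star ((G : Cn n → ℂ) z) * evalFun (tang i j (tangBar i j P)) z := by
    intro z
    have : evalFun (polyBox P) (z : Cn n)
        = -∑ i, ∑ j, evalFun (tang i j (tangBar i j P)) (z : Cn n) := by
      simp only [polyBox, evalFun, map_neg, map_sum]
    rw [this, mul_neg, Finset.mul_sum]
    simp only [Finset.mul_sum]
  simp only [hR]
  rw [integral_neg, integral_finsetSum _ fun i _ => integrable_finsetSum _ fun j _ => hi1 i j,
    integral_finsetSum _ fun i _ => integrable_finsetSum _ fun j _ => hi2 i j,
    ← Finset.sum_neg_distrib]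
  refine Finset.sum_congr rfl fun i _ => ?_
  rw [integral_finsetSum _ fun j _ => hi1 i j, integral_finsetSum _ fun j _ => hi2 i j,
    ← Finset.sum_neg_distrib]
  exact Finset.sum_congr rfl fun j _ => integral_tangBar G _ i j

/-! ### The Kohn Laplacian on bihomogeneous polynomials -/

/-- The bidegree of the coordinates: `(1, 0)` for `zᵢ` and `(0, 1)` for `z̄ᵢ`. -/
def biweight (n : ℕ) : Fin n ⊕ Fin n → ℕ × ℕ := Sum.elim (fun _ => (1, 0)) (fun _ => (0, 1))

/-- The polynomials that are homogeneous of degree `p` in `z` and of degree `q` in `z̄`. -/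
noncomputable def bihom (n p q : ℕ) : Submodule ℂ (Poly n) :=
  weightedHomogeneousSubmodule ℂ (biweight n) (p, q)

theorem mem_bihom {p q : ℕ} {P : Poly n} :
    P ∈ bihom n p q ↔ IsWeightedHomogeneous (biweight n) P (p, q) := Iff.rfl

/-- Euler's identity in the variables `z`. -/
theorem euler_inl {p q : ℕ} {P : Poly n} (hP : P ∈ bihom n p q) :
    ∑ j, X (Sum.inl j) * pderiv (Sum.inl j) P = (p : ℂ) • P := by
  have h : IsWeightedHomogeneous (Sum.elim (fun _ : Fin n => 1) (fun _ : Fin n => 0)) P p := by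
    intro d hd
    have := congrArg Prod.fst (mem_bihom.mp hP hd)
    change _ = p at this
    rw [← this]
    simp only [Finsupp.weight_apply, Finsupp.sum, Prod.fst_sum]
    refine Finset.sum_congr rfl fun s _ => ?_
    cases s <;> simp [biweight]
  have := h.sum_weight_X_mul_pderiv
  rw [Fintype.sum_sum_type] at this
  simpa [Nat.cast_smul_eq_nsmul] using this

/-- Euler's identity in the variables `z̄`. -/
theorem euler_inr {p q : ℕ} {P : Poly n} (hP : P ∈ bihom n p q) :
    ∑ j, X (Sum.inr j) * pderiv (Sum.inr j) P = (q : ℂ) • P := by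
  have h : IsWeightedHomogeneous (Sum.elim (fun _ : Fin n => 0) (fun _ : Fin n => 1)) P q := by
    intro d hd
    have := congrArg Prod.snd (mem_bihom.mp hP hd)
    change _ = q at this
    rw [← this]
    simp only [Finsupp.weight_apply, Finsupp.sum, Prod.snd_sum]
    refine Finset.sum_congr rfl fun s _ => ?_
    cases s <;> simp [biweight]
  have := h.sum_weight_X_mul_pderiv
  rw [Fintype.sum_sum_type] at this
  simpa [Nat.cast_smul_eq_nsmul] using this

theorem pderiv_inl_mem_bihom {p q : ℕ} {P : Poly n} (hP : P ∈ bihom n (p + 1) q) (i : Fin n) :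
    pderiv (Sum.inl i) P ∈ bihom n p q :=
  (mem_bihom.mp hP).pderiv (by simp [biweight])

theorem pderiv_inr_mem_bihom {p q : ℕ} {P : Poly n} (hP : P ∈ bihom n p (q + 1)) (i : Fin n) :
    pderiv (Sum.inr i) P ∈ bihom n p q :=
  (mem_bihom.mp hP).pderiv (by simp [biweight])

theorem pderiv_inl_eq_zero {q : ℕ} {P : Poly n} (hP : P ∈ bihom n 0 q) (i : Fin n) :
    pderiv (Sum.inl i) P = 0 := by
  refine pderiv_eq_zero_of_notMem_vars fun h => ?_
  obtain ⟨d, hd, hi⟩ := (mem_vars_iff_mem_support _).mp h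
  have h1 := congrArg Prod.fst (mem_bihom.mp hP (mem_support_iff.mp hd))
  simp only [Finsupp.weight_apply, Finsupp.sum, Prod.fst_sum, Finset.sum_eq_zero_iff] at h1
  have := h1 _ hi
  rw [Finsupp.mem_support_iff] at hi
  simp [biweight] at this
  exact hi this

theorem pderiv_inr_eq_zero {p : ℕ} {P : Poly n} (hP : P ∈ bihom n p 0) (i : Fin n) :
    pderiv (Sum.inr i) P = 0 := by
  refine pderiv_eq_zero_of_notMem_vars fun h => ?_
  obtain ⟨d, hd, hi⟩ := (mem_vars_iff_mem_support _).mp h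
  have h1 := congrArg Prod.snd (mem_bihom.mp hP (mem_support_iff.mp hd))
  simp only [Finsupp.weight_apply, Finsupp.sum, Prod.snd_sum, Finset.sum_eq_zero_iff] at h1
  have := h1 _ hi
  rw [Finsupp.mem_support_iff] at hi
  simp [biweight] at this
  exact hi this

/-- The polynomial `|z|² = ∑ zₐ z̄ₐ`. -/
noncomputable def normSqPoly (n : ℕ) : Poly n := ∑ a, X (Sum.inl a) * X (Sum.inr a)

/-- A quarter of the Euclidean Laplacian, `∑ ∂ₐ ∂̄ₐ`. -/
noncomputable def polyLap (P : Poly n) : Poly n :=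
  ∑ a, pderiv (Sum.inl a) (pderiv (Sum.inr a) P)

/-- The commutation relations give
`□_b = 2 ((n - 1) ∑ z̄ᵢ ∂̄ᵢ + ∑ z̄ᵢ zⱼ ∂ⱼ ∂̄ᵢ - |z|² ∑ ∂ₐ ∂̄ₐ)`. -/
theorem polyBox_eq (P : Poly n) :
    polyBox P = (2 : ℂ) • (((n : ℂ) - 1) • (∑ i, X (Sum.inr i) * pderiv (Sum.inr i) P)
      + ∑ i, X (Sum.inr i) * ∑ j, X (Sum.inl j) * pderiv (Sum.inl j) (pderiv (Sum.inr i) P)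
      - normSqPoly n * polyLap P) := by
  -- The `(i, j)` summand of `-□_b` is `A i j + A j i`.
  set A : Fin n → Fin n → Poly n := fun i j =>
    (if i = j then X (Sum.inr i) * pderiv (Sum.inr i) P else 0)
      + (X (Sum.inl i) * X (Sum.inr i)) * pderiv (Sum.inl j) (pderiv (Sum.inr j) P)
      - X (Sum.inr i) * pderiv (Sum.inr i) P
      - X (Sum.inr i) * (X (Sum.inl j) * pderiv (Sum.inl j) (pderiv (Sum.inr i) P)) with hA
  have hT : ∀ i j, tang i j (tangBar i j P) = A i j + A j i := by
    intro i j
    simp only [hA, tang, tangBar, map_sub, Derivation.leibniz, pderiv_X, smul_eq_mul]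
    by_cases h : i = j
    · subst h
      simp
      ring
    · simp [h, Ne.symm h]
      ring
  have hS : ∑ i, ∑ j, A i j = -(((n : ℂ) - 1) • (∑ i, X (Sum.inr i) * pderiv (Sum.inr i) P)
      + ∑ i, X (Sum.inr i) * ∑ j, X (Sum.inl j) * pderiv (Sum.inl j) (pderiv (Sum.inr i) P)
      - normSqPoly n * polyLap P) := by
    simp only [hA, Finset.sum_add_distrib, Finset.sum_sub_distrib, Finset.sum_ite_eq,
      Finset.mem_univ, if_true, ← Finset.mul_sum, ← Finset.sum_mul, Finset.sum_const,
      Finset.card_univ, Fintype.card_fin, mul_smul_comm,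
      ← Finset.smul_sum]
    rw [sub_smul, one_smul, Nat.cast_smul_eq_nsmul, normSqPoly, polyLap]
    generalize (∑ i : Fin n, X (Sum.inr i) * pderiv (Sum.inr i) P) = S₁
    generalize (∑ i : Fin n, X (Sum.inr i) * ∑ j : Fin n, X (Sum.inl j) *
      pderiv (Sum.inl j) (pderiv (Sum.inr i) P)) = S₂
    generalize (∑ i : Fin n, X (Sum.inl i) * X (Sum.inr i) : Poly n) *
      (∑ i : Fin n, pderiv (Sum.inl i) (pderiv (Sum.inr i) P)) = S₃
    abel
  rw [polyBox]
  simp only [hT, Finset.sum_add_distrib]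
  rw [Finset.sum_comm (f := fun i j => A j i), hS, two_smul]
  abel

/-- On bidegree `(p, q)` the Kohn Laplacian is the scalar `2 q (p + n - 1)` up to a multiple
of `|z|²`. -/
theorem polyBox_bihom {p q : ℕ} {P : Poly n} (hP : P ∈ bihom n p q) :
    polyBox P = (2 * q * (p + n - 1) : ℂ) • P - (2 : ℂ) • (normSqPoly n * polyLap P) := by
  have h : ∑ i, X (Sum.inr i) * ∑ j, X (Sum.inl j) * pderiv (Sum.inl j) (pderiv (Sum.inr i) P)
      = ((p : ℂ) * q) • P := by
    rcases q with _ | q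
    · simp [pderiv_inr_eq_zero hP]
    · have h1 : ∀ i, ∑ j, X (Sum.inl j) * pderiv (Sum.inl j) (pderiv (Sum.inr i) P)
          = (p : ℂ) • pderiv (Sum.inr i) P := fun i => euler_inl (pderiv_inr_mem_bihom hP i)
      simp only [h1, mul_smul_comm, ← Finset.smul_sum, euler_inr hP, smul_smul]
  rw [polyBox_eq, euler_inr hP, h]
  module

theorem evalFun_normSqPoly (z : Sph n) : evalFun (normSqPoly n) z = 1 := by
  rw [← sum_star_mul_self z]
  simp [normSqPoly, evalFun, coordFun, mul_comm]

theorem toL2_congr {F G : smoothFun n} (h : ∀ z : Sph n, (F : Cn n → ℂ) z = (G : Cn n → ℂ) z) :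
    toL2 n F = toL2 n G := by
  have : restrictC n F = restrictC n G := by
    ext z
    exact h z
  simp only [toL2, LinearMap.comp_apply, this]

theorem polyL2_normSqPoly_mul (P : Poly n) : polyL2 n (normSqPoly n * P) = polyL2 n P := by
  refine toL2_congr fun z => ?_
  simp only [coe_polySmooth]
  have := evalFun_normSqPoly z
  simp only [evalFun, map_mul] at this ⊢
  rw [this, one_mul]

theorem polyL2_polyBox {p q : ℕ} {P : Poly n} (hP : P ∈ bihom n p q) :
    polyL2 n (polyBox P)
      = (2 * q * (p + n - 1) : ℂ) • polyL2 n P - (2 : ℂ) • polyL2 n (polyLap P) := by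
  rw [polyBox_bihom hP, map_sub, map_smul, map_smul, polyL2_normSqPoly_mul]

/-! ### Bihomogeneous polynomials on the sphere -/

/-- The restrictions to the sphere of the polynomials of bidegree `(p, q)`. -/
noncomputable def bihomL2 (n p q : ℕ) : Submodule ℂ (L2 n) := (bihom n p q).map (polyL2 n)

/-- The restrictions to the sphere of the polynomials of bidegree `(p - 1, q - 1)`, which is zero
if `p = 0` or `q = 0`. -/
noncomputable def bihomL2Pred (n : ℕ) : ℕ → ℕ → Submodule ℂ (L2 n)
  | p + 1, q + 1 => bihomL2 n p q
  | _, _ => ⊥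

theorem polyL2_polyLap_mem {p q : ℕ} {P : Poly n} (hP : P ∈ bihom n p q) :
    polyL2 n (polyLap P) ∈ bihomL2Pred n p q := by
  rcases p with _ | p
  · rcases q with _ | q
    · simp [polyLap, pderiv_inr_eq_zero hP]
    · simp [polyLap, pderiv_inl_eq_zero (pderiv_inr_mem_bihom hP _)]
  · rcases q with _ | q
    · simp [polyLap, pderiv_inr_eq_zero hP]
    · exact Submodule.mem_map_of_mem (Submodule.sum_mem _ fun i _ =>
        pderiv_inl_mem_bihom (pderiv_inr_mem_bihom hP i) i)

theorem normSqPoly_mul_mem {p q : ℕ} {P : Poly n} (hP : P ∈ bihom n p q) :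
    normSqPoly n * P ∈ bihom n (p + 1) (q + 1) := by
  have h : IsWeightedHomogeneous (biweight n) (normSqPoly n) (1, 1) := by
    refine IsWeightedHomogeneous.sum _ _ _ fun i _ => ?_
    exact (isWeightedHomogeneous_X ℂ (biweight n) (Sum.inl i)).mul
      (isWeightedHomogeneous_X ℂ (biweight n) (Sum.inr i))
  have := h.mul (mem_bihom.mp hP)
  rw [mem_bihom]
  convert this using 1
  simp [add_comm]

/-- Multiplication by `|z|²`, which is `1` on the sphere, raises the bidegree by `(1, 1)`. -/
theorem bihomL2_le_succ (n p q : ℕ) : bihomL2 n p q ≤ bihomL2 n (p + 1) (q + 1) := by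
  rintro _ ⟨P, hP, rfl⟩
  exact ⟨normSqPoly n * P, normSqPoly_mul_mem hP, polyL2_normSqPoly_mul P⟩

theorem bihomL2Pred_le (n p q : ℕ) : bihomL2Pred n p q ≤ bihomL2 n p q := by
  rcases p with _ | p
  · exact bot_le
  · rcases q with _ | q
    · exact bot_le
    · exact bihomL2_le_succ n p q

/-! ### Dimensions of spaces of bihomogeneous polynomials -/

theorem weight_biweight (d : Fin n ⊕ Fin n →₀ ℕ) :
    Finsupp.weight (biweight n) d = (∑ i, d (Sum.inl i), ∑ i, d (Sum.inr i)) := by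
  rw [Finsupp.weight_apply, Finsupp.sum_fintype _ _ (by simp), Fintype.sum_sum_type]
  ext <;> simp [biweight, Prod.fst_sum, Prod.snd_sum]

/-- The exponents of bidegree `(p, q)` are pairs of an exponent of degree `p` and one of
degree `q`. -/
noncomputable def bihomExponents (n p q : ℕ) :
    {d : Fin n ⊕ Fin n →₀ ℕ | Finsupp.weight (biweight n) d = (p, q)}
      ≃ (Finset.univ : Finset (Fin n)).finsuppAntidiag p
        × (Finset.univ : Finset (Fin n)).finsuppAntidiag q :=
  (Finsupp.sumFinsuppEquivProdFinsupp.subtypeEquiv fun d => by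
    simp [weight_biweight, Finset.mem_finsuppAntidiag]
    rfl).trans
  (Equiv.subtypeProdEquivProd (p := (· ∈ (Finset.univ : Finset (Fin n)).finsuppAntidiag p))
    (q := (· ∈ (Finset.univ : Finset (Fin n)).finsuppAntidiag q)))

/-- The monomial basis of the polynomials of bidegree `(p, q)`. -/
noncomputable def bihomBasis (n p q : ℕ) :
    Module.Basis ((Finset.univ : Finset (Fin n)).finsuppAntidiag p
        × (Finset.univ : Finset (Fin n)).finsuppAntidiag q) ℂ (bihom n p q) :=
  ((basisRestrictSupport ℂ _).map (LinearEquiv.ofEq _ _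
    (weightedHomogeneousSubmodule_eq_finsupp_supported ℂ (biweight n) (p, q)).symm)).reindex
      (bihomExponents n p q)

instance (n p q : ℕ) : FiniteDimensional ℂ (bihom n p q) :=
  (bihomBasis n p q).finiteDimensional_of_finite

theorem finrank_bihom (n p q : ℕ) :
    Module.finrank ℂ (bihom n p q) = n.multichoose p * n.multichoose q := by
  rw [Module.finrank_eq_card_basis (bihomBasis n p q), Fintype.card_prod, Fintype.card_coe,
    Fintype.card_coe, Finset.card_finsuppAntidiag_nat_eq_multichoose,
    Finset.card_finsuppAntidiag_nat_eq_multichoose, Finset.card_univ, Fintype.card_fin]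

theorem evalFun_smul {p q : ℕ} {P : Poly n} (hP : P ∈ bihom n p q) (r : ℝ) (z : Cn n) :
    evalFun P (r • z) = (r : ℂ) ^ (p + q) * evalFun P z := by
  have h : ∀ s, coordFun s (r • z) = r * coordFun s z := by
    rintro (i | i) <;> simp [coordFun]
  simp only [evalFun, eval_eq', h, Finset.mul_sum]
  refine Finset.sum_congr rfl fun d hd => ?_
  have hw := mem_bihom.mp hP (mem_support_iff.mp hd)
  rw [weight_biweight, Prod.mk.injEq] at hw
  rw [← hw.1, ← hw.2, ← Fintype.sum_sum_type (fun s => d s), ← Finset.prod_pow_eq_pow_sum]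
  simp only [mul_pow, Finset.prod_mul_distrib]
  ring

/-- A polynomial in `z` and `z̄` is determined by the function it defines. -/
theorem eq_zero_of_evalFun {P : Poly n} (h : ∀ z, evalFun P z = 0) : P = 0 := by
  -- Substitute `z = x + iy`, `z̄ = x - iy`: the resulting polynomial in `x`, `y` vanishes at all
  -- real points, hence identically, and the substitution is invertible over `ℂ`.
  set Q : Poly n := bind₁ (Sum.elim (fun i => X (Sum.inl i) + C Complex.I * X (Sum.inr i))
    (fun i => X (Sum.inl i) - C Complex.I * X (Sum.inr i))) P with hQ
  have hev : ∀ w : Fin n ⊕ Fin n → ℂ, eval w Q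
      = eval (Sum.elim (fun i => w (Sum.inl i) + Complex.I * w (Sum.inr i))
        (fun i => w (Sum.inl i) - Complex.I * w (Sum.inr i))) P := by
    intro w
    refine (eval₂Hom_bind₁ (RingHom.id ℂ) w _ P).trans ?_
    change eval _ P = _
    congr 2
    funext s
    cases s <;> simp
  have hQ0 : Q = 0 := by
    refine funext_set (fun _ => Set.range ((↑) : ℝ → ℂ))
      (fun _ => Set.infinite_range_of_injective Complex.ofReal_injective) fun w hw => ?_
    choose x hx using fun s => hw s (Set.mem_univ s)
    rw [hev, map_zero]
    convert h (WithLp.toLp 2 fun i => (x (Sum.inl i) : ℂ) + Complex.I * x (Sum.inr i)) using 1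
    rw [evalFun]
    congr 2
    funext s
    rcases s with i | i
    · simp [coordFun, hx]
    · simp only [← hx, Sum.elim_inr, coordFun, Complex.star_def, map_add, map_mul,
        Complex.conj_ofReal, Complex.conj_I]
      ring
  refine MvPolynomial.funext fun w => ?_
  have := hev (Sum.elim (fun i => (w (Sum.inl i) + w (Sum.inr i)) / 2)
    (fun i => -Complex.I * (w (Sum.inl i) - w (Sum.inr i)) / 2))
  rw [hQ0, map_zero] at this
  rw [map_zero, this]
  congr 2
  funext s
  rcases s with i | i
  · simp only [Sum.elim_inl, Sum.elim_inr]
    linear_combination ((w (Sum.inl i) - w (Sum.inr i)) / 2) * Complex.I_sq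
  · simp only [Sum.elim_inl, Sum.elim_inr]
    linear_combination (-(w (Sum.inl i) - w (Sum.inr i)) / 2) * Complex.I_sq

/-- By homogeneity, a polynomial of bidegree `(p, q)` is determined by its restriction to the
sphere. -/
theorem eq_zero_of_polyL2 (hn : n ≠ 0) {p q : ℕ} {P : Poly n} (hP : P ∈ bihom n p q)
    (h : polyL2 n P = 0) : P = 0 := by
  have h1 : restrictC n (polySmooth n P) = 0 := by
    apply ContinuousMap.toLp_injective (p := 2) (𝕜 := ℂ) (surf n)
    rw [map_zero]
    exact h
  have h2 : ∀ z : Sph n, evalFun P z = 0 := fun z => DFunLike.congr_fun h1 z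
  have : NeZero n := ⟨hn⟩
  refine eq_zero_of_evalFun fun z => ?_
  rcases eq_or_ne z 0 with rfl | hz
  · have := evalFun_smul hP 0 (EuclideanSpace.single (0 : Fin n) (1 : ℂ))
    rw [zero_smul] at this
    rw [this, h2 ⟨_, by simp⟩, mul_zero]
  · have hz' : ‖z‖ ≠ 0 := norm_ne_zero_iff.mpr hz
    have := evalFun_smul hP ‖z‖ (‖z‖⁻¹ • z)
    rw [smul_smul, mul_inv_cancel₀ hz', one_smul] at this
    rw [this, h2 ⟨‖z‖⁻¹ • z, by simp [norm_smul, hz']⟩, mul_zero]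

theorem finrank_bihomL2 (hn : n ≠ 0) (p q : ℕ) :
    Module.finrank ℂ (bihomL2 n p q) = n.multichoose p * n.multichoose q := by
  rw [← finrank_bihom, bihomL2, ← LinearMap.range_domRestrict]
  refine LinearMap.finrank_range_of_inj ?_
  rw [← LinearMap.ker_eq_bot, LinearMap.ker_eq_bot']
  exact fun P hP => Subtype.ext (eq_zero_of_polyL2 hn P.2 hP)

/-! ### Density of polynomials -/

/-- Polynomials in `z` and `z̄` are dense in `L²` of the sphere, by Stone-Weierstrass. -/
theorem denseRange_polyL2 (n : ℕ) : (LinearMap.range (polyL2 n)).topologicalClosure = ⊤ := by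
  let A : StarSubalgebra ℂ C(Sph n, ℂ) :=
    { carrier := Set.range fun P : Poly n => restrictC n (polySmooth n P)
      mul_mem' := by
        rintro _ _ ⟨P, rfl⟩ ⟨Q, rfl⟩
        exact ⟨P * Q, by ext z; simp [restrictC, coe_polySmooth, evalFun]⟩
      one_mem' := ⟨1, by ext z; simp [restrictC, coe_polySmooth, evalFun]⟩
      add_mem' := by
        rintro _ _ ⟨P, rfl⟩ ⟨Q, rfl⟩
        exact ⟨P + Q, by simp⟩
      zero_mem' := ⟨0, by simp⟩
      algebraMap_mem' := fun r => ⟨C r, by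
        ext z; simp [restrictC, coe_polySmooth, evalFun]⟩
      star_mem' := by
        rintro _ ⟨P, rfl⟩
        refine ⟨rename Sum.swap (map (starRingEnd ℂ) P), ?_⟩
        ext z
        change evalFun _ (z : Cn n) = star (evalFun P z)
        have h : (fun s => coordFun s (z : Cn n)) ∘ Sum.swap
            = starRingEnd ℂ ∘ fun s => coordFun s (z : Cn n) := by
          funext s
          cases s <;> simp [coordFun]
        rw [evalFun, eval_rename, h, ← map_eval]
        rfl }
  have hA : A.topologicalClosure = ⊤ := by
    refine ContinuousMap.starSubalgebra_topologicalClosure_eq_top_of_separatesPoints A ?_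
    intro x y hxy
    have : ∃ i, (x : Cn n) i ≠ (y : Cn n) i := by
      by_contra! h
      exact hxy (Subtype.ext (PiLp.ext h))
    obtain ⟨i, hi⟩ := this
    refine ⟨_, ⟨restrictC n (polySmooth n (X (Sum.inl i))), ⟨_, rfl⟩, rfl⟩, ?_⟩
    simpa [restrictC, coe_polySmooth, evalFun, coordFun] using hi
  have hd : Dense (A : Set C(Sph n, ℂ)) := by
    intro f
    have : f ∈ A.topologicalClosure := hA ▸ StarSubalgebra.mem_top
    exact this
  have h2 := (ContinuousMap.toLp_denseRange ℂ (surf n) (p := 2) ℂ (by simp)).dense_image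
    (ContinuousMap.toLp 2 (surf n) ℂ : C(Sph n, ℂ) →L[ℂ] L2 n).continuous hd
  rw [← Submodule.dense_iff_topologicalClosure_eq_top]
  refine h2.mono ?_
  rintro _ ⟨_, ⟨P, rfl⟩, rfl⟩
  exact ⟨P, rfl⟩

theorem polyL2_mem_iSup (P : Poly n) : polyL2 n P ∈ ⨆ d : ℕ × ℕ, bihomL2 n d.1 d.2 := by
  rw [P.as_sum, map_sum]
  refine Submodule.sum_mem _ fun d _ => ?_
  refine Submodule.mem_iSup_of_mem (Finsupp.weight (biweight n) d) ⟨_, ?_, rfl⟩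
  exact isWeightedHomogeneous_monomial _ _ _ rfl

theorem dense_iSup_bihomL2 (n : ℕ) :
    (⨆ d : ℕ × ℕ, bihomL2 n d.1 d.2).topologicalClosure = ⊤ := by
  rw [eq_top_iff, ← denseRange_polyL2]
  refine Submodule.topologicalClosure_mono ?_
  rintro _ ⟨P, rfl⟩
  exact polyL2_mem_iSup P

/-! ### The operator on polynomials, and its symmetry -/

theorem toL2_mem_domain (F : smoothFun n) : toL2 n F ∈ (dbarB n).domain :=
  (LinearPMap.le_closure _).1 (LinearMap.mem_range_self _ F)

theorem dbarB_toL2 (F : smoothFun n) : dbarB n ⟨toL2 n F, toL2_mem_domain F⟩ = dbarL2 n F := by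
  rw [← dbarSmooth_apply F]
  exact ((LinearPMap.le_closure (dbarSmooth n)).2 rfl).symm

theorem dense_domain_dbarB (n : ℕ) : Dense ((dbarB n).domain : Set (L2 n)) := by
  have := Submodule.dense_iff_topologicalClosure_eq_top.mpr (denseRange_polyL2 n)
  refine this.mono ?_
  rintro _ ⟨P, rfl⟩
  exact toL2_mem_domain _

/-- The graph of `T.closure` lies in the closure of the graph of `T`, also when `T` is not closable
and `T.closure` is `T` by convention. Hence identities that hold on smooth functions extend to the
domain of `∂̄_b` without appeal to closability. -/
theorem mem_closure_graph_of_closure {E F : Type*} [NormedAddCommGroup E] [NormedSpace ℂ E]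
    [NormedAddCommGroup F] [NormedSpace ℂ F] (T : E →ₗ.[ℂ] F) (x : T.closure.domain) :
    ((x : E), T.closure x) ∈ T.graph.topologicalClosure := by
  by_cases hT : T.IsClosable
  · rw [hT.graph_closure_eq_closure_graph]
    exact LinearPMap.mem_graph _ x
  · have h := LinearPMap.mem_graph T.closure x
    have h2 : T.closure.graph = T.graph := by rw [LinearPMap.closure_def' hT]
    rw [h2] at h
    exact Submodule.le_topologicalClosure _ h

/-- `∂̄_b P` lies in the domain of `∂̄_b^*`, with image `□_b P`, for a polynomial `P`. -/
theorem inner_dbarB (P : Poly n) (x : (dbarB n).domain) :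
    inner ℂ (polyL2 n (polyBox P)) (x : L2 n)
      = inner ℂ (dbarL2 n (polySmooth n P)) (dbarB n x) := by
  have h := mem_closure_graph_of_closure (dbarSmooth n) x
  have hc : IsClosed {v : L2 n × forms n | inner ℂ (polyL2 n (polyBox P)) v.1
      = inner ℂ (dbarL2 n (polySmooth n P)) v.2} :=
    isClosed_eq (continuous_const.inner continuous_fst) (by
      simp only [Submodule.coe_inner]
      exact continuous_const.inner (continuous_subtype_val.comp continuous_snd))
  refine hc.closure_subset_iff.mpr ?_ h
  rintro ⟨u, v⟩ huv
  obtain ⟨y, rfl, rfl⟩ := (LinearPMap.mem_graph_iff _).mp huv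
  obtain ⟨_, F, rfl⟩ := y
  change inner ℂ (polyL2 n (polyBox P)) (toL2 n F) = inner ℂ (dbarL2 n (polySmooth n P))
    (dbarSmooth n ⟨toL2 n F, LinearMap.mem_range_self _ F⟩)
  rw [dbarSmooth_apply, ← inner_conj_symm, ← inner_dbarL2_polySmooth]
  exact inner_conj_symm (𝕜 := ℂ) (E := forms n) _ _

theorem dbarL2_mem_domain (P : Poly n) : dbarL2 n (polySmooth n P) ∈ (dbarBStar n).domain :=
  LinearPMap.mem_adjoint_domain_of_exists _ ⟨_, inner_dbarB P⟩

theorem polyL2_mem_domain (P : Poly n) : polyL2 n P ∈ (kohnLaplacian n).domain := by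
  rw [kohnLaplacian, mem_pcomp_domain]
  refine ⟨toL2_mem_domain _, ?_⟩
  change dbarB n ⟨toL2 n (polySmooth n P), _⟩ ∈ _
  rw [dbarB_toL2]
  exact dbarL2_mem_domain P

theorem kohnLaplacian_polyL2 (P : Poly n) :
    kohnLaplacian n ⟨polyL2 n P, polyL2_mem_domain P⟩ = polyL2 n (polyBox P) := by
  have h1 := dbarB_toL2 (polySmooth n P)
  have h2 : dbarB n ⟨toL2 n (polySmooth n P), toL2_mem_domain _⟩ ∈ (dbarBStar n).domain := by
    rw [h1]; exact dbarL2_mem_domain P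
  refine (pcomp_apply (dbarBStar n) (dbarB n) ⟨polyL2 n P, polyL2_mem_domain P⟩
    (toL2_mem_domain _) h2).trans ?_
  refine LinearPMap.adjoint_apply_eq (dense_domain_dbarB n) ⟨_, h2⟩ fun x => ?_
  rw [inner_dbarB]
  simp only [h1]

theorem inner_kohnLaplacian (x y : (kohnLaplacian n).domain) :
    inner ℂ (kohnLaplacian n x) (y : L2 n) = inner ℂ (x : L2 n) (kohnLaplacian n y) := by
  obtain ⟨hx, hx'⟩ := (mem_pcomp_domain _ _ _).mp x.2
  obtain ⟨hy, hy'⟩ := (mem_pcomp_domain _ _ _).mp y.2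
  have h := LinearPMap.adjoint_isFormalAdjoint (dense_domain_dbarB n)
  have e1 : kohnLaplacian n x = dbarBStar n ⟨dbarB n ⟨x, hx⟩, hx'⟩ := pcomp_apply _ _ x hx hx'
  have e2 : kohnLaplacian n y = dbarBStar n ⟨dbarB n ⟨y, hy⟩, hy'⟩ := pcomp_apply _ _ y hy hy'
  rw [e1, e2]
  have a1 : inner ℂ (dbarBStar n ⟨dbarB n ⟨x, hx⟩, hx'⟩) (y : L2 n)
    = inner ℂ (dbarB n ⟨x, hx⟩) (dbarB n ⟨y, hy⟩) := h ⟨_, hx'⟩ ⟨y, hy⟩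
  have a2 : inner ℂ (dbarBStar n ⟨dbarB n ⟨y, hy⟩, hy'⟩) (x : L2 n)
    = inner ℂ (dbarB n ⟨y, hy⟩) (dbarB n ⟨x, hx⟩) := h ⟨_, hy'⟩ ⟨x, hx⟩
  rw [a1, ← inner_conj_symm (x : L2 n), a2]
  exact (inner_conj_symm (𝕜 := ℂ) (E := forms n) _ _).symm

/-- Eigenvectors for different eigenvalues are orthogonal. -/
theorem inner_eq_zero_of_eigenspace {s t : ℝ} (hst : s ≠ t) {x y : L2 n}
    (hx : x ∈ eigenspace (kohnLaplacian n) s) (hy : y ∈ eigenspace (kohnLaplacian n) t) :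
    inner ℂ x y = 0 := by
  obtain ⟨hx, ex⟩ := (mem_eigenspace _ _ _).mp hx
  obtain ⟨hy, ey⟩ := (mem_eigenspace _ _ _).mp hy
  have h := inner_kohnLaplacian ⟨x, hx⟩ ⟨y, hy⟩
  simp only [ex, ey, inner_smul_left, inner_smul_right, Complex.conj_ofReal] at h
  have h' : ((s : ℂ) - t) * inner ℂ x y = 0 := by rw [sub_mul, h, sub_self]
  refine (mul_eq_zero.mp h').resolve_left ?_
  exact sub_ne_zero.mpr (by exact_mod_cast hst)

/-! ### Diagonalization by spherical harmonics -/

/-- The spherical harmonics of bidegree `(p, q)`: the restrictions of polynomials of bidegree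
`(p, q)` that are orthogonal to those of bidegree `(p - 1, q - 1)`. -/
noncomputable def harmonics (n p q : ℕ) : Submodule ℂ (L2 n) :=
  (bihomL2Pred n p q)ᗮ ⊓ bihomL2 n p q

theorem bihomL2Pred_stable {p q : ℕ} {f : L2 n} (hf : f ∈ bihomL2Pred n p q) :
    ∃ h : f ∈ (kohnLaplacian n).domain, kohnLaplacian n ⟨f, h⟩ ∈ bihomL2Pred n p q := by
  have h0 : ∃ h : (0 : L2 n) ∈ (kohnLaplacian n).domain,
      kohnLaplacian n ⟨0, h⟩ ∈ (⊥ : Submodule ℂ (L2 n)) :=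
    ⟨Submodule.zero_mem _, by
      rw [Submodule.mem_bot]; exact (kohnLaplacian n).map_zero⟩
  rcases p with _ | p
  · obtain rfl := (Submodule.mem_bot ℂ).mp hf
    exact h0
  · rcases q with _ | q
    · obtain rfl := (Submodule.mem_bot ℂ).mp hf
      exact h0
    · obtain ⟨P, hP, rfl⟩ := hf
      refine ⟨polyL2_mem_domain P, ?_⟩
      rw [kohnLaplacian_polyL2, polyL2_polyBox hP]
      exact Submodule.sub_mem _ (Submodule.smul_mem _ _ ⟨P, hP, rfl⟩)
        (Submodule.smul_mem _ _ (bihomL2Pred_le n p q (polyL2_polyLap_mem hP)))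

/-- The eigenvalue `2 q (p + n - 1)` of the Kohn Laplacian on harmonics of bidegree `(p, q)`. -/
noncomputable def kohnEigenvalue (n p q : ℕ) : ℝ := 2 * q * (p + n - 1)

/-- The Kohn Laplacian is triangular for the filtration by bidegree, and symmetric, hence diagonal
on the orthogonal complements. -/
theorem harmonics_le_eigenspace (n p q : ℕ) :
    harmonics n p q ≤ eigenspace (kohnLaplacian n) (kohnEigenvalue n p q) := by
  rintro f ⟨hf, P, hP, rfl⟩
  rw [mem_eigenspace]
  refine ⟨polyL2_mem_domain P, ?_⟩
  set g := (2 : ℂ) • polyL2 n (polyLap P) with hg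
  have hgm : g ∈ bihomL2Pred n p q := Submodule.smul_mem _ _ (polyL2_polyLap_mem hP)
  have e : kohnLaplacian n ⟨polyL2 n P, polyL2_mem_domain P⟩
      = (kohnEigenvalue n p q : ℂ) • polyL2 n P - g := by
    rw [kohnLaplacian_polyL2, polyL2_polyBox hP]
    simp [kohnEigenvalue, hg]
  -- The Kohn Laplacian maps the lower-order space containing `g` to itself, so by symmetry `g` is
  -- orthogonal to itself.
  obtain ⟨hgd, hgs⟩ := bihomL2Pred_stable hgm
  have hsym := inner_kohnLaplacian ⟨g, hgd⟩ ⟨polyL2 n P, polyL2_mem_domain P⟩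
  simp only [e] at hsym
  rw [(Submodule.mem_orthogonal _ _).mp hf _ hgs, inner_sub_right, inner_smul_right,
    (Submodule.mem_orthogonal _ _).mp hf _ hgm, mul_zero, zero_sub, zero_eq_neg,
    inner_self_eq_zero] at hsym
  rw [e, hsym, sub_zero]

instance (n p q : ℕ) : FiniteDimensional ℂ (bihomL2 n p q) :=
  inferInstanceAs (FiniteDimensional ℂ ((bihom n p q).map (polyL2 n)))

instance (n p q : ℕ) : FiniteDimensional ℂ (bihomL2Pred n p q) :=
  Submodule.finiteDimensional_of_le (bihomL2Pred_le n p q)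

instance (n p q : ℕ) : FiniteDimensional ℂ (harmonics n p q) :=
  Submodule.finiteDimensional_of_le (inf_le_right : _ ≤ bihomL2 n p q)

/-- Iterating the decomposition of bidegree `(p, q)` into harmonics and the part of bidegree
`(p - 1, q - 1)`. -/
theorem bihomL2_le_iSup_harmonics (n p q : ℕ) :
    bihomL2 n p q ≤ ⨆ d : ℕ × ℕ, harmonics n d.1 d.2 := by
  induction p generalizing q with
  | zero =>
    have h : bihomL2 n 0 q = harmonics n 0 q := by simp [harmonics, bihomL2Pred]
    rw [h]
    exact le_iSup (fun d : ℕ × ℕ => harmonics n d.1 d.2) (0, q)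
  | succ p ih =>
    rw [← Submodule.sup_orthogonal_inf_of_hasOrthogonalProjection (bihomL2Pred_le n (p + 1) q)]
    refine sup_le ?_ (le_iSup (fun d : ℕ × ℕ => harmonics n d.1 d.2) (p + 1, q))
    rcases q with _ | q
    · exact bot_le
    · exact ih q

/-- The harmonics of all bidegrees span a dense subspace of `L²`. -/
theorem eq_zero_of_orthogonal_harmonics {f : L2 n}
    (hf : ∀ p q, ∀ g ∈ harmonics n p q, inner ℂ g f = 0) : f = 0 := by
  have h1 : (⨆ d : ℕ × ℕ, bihomL2 n d.1 d.2) ≤ ⨆ d : ℕ × ℕ, harmonics n d.1 d.2 :=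
    iSup_le fun d => bihomL2_le_iSup_harmonics n d.1 d.2
  have h2 : (⨆ d : ℕ × ℕ, harmonics n d.1 d.2).topologicalClosure = ⊤ := by
    rw [eq_top_iff, ← dense_iSup_bihomL2]
    exact Submodule.topologicalClosure_mono h1
  have h3 : (⨆ d : ℕ × ℕ, harmonics n d.1 d.2)ᗮ = ⊥ :=
    (Submodule.topologicalClosure_eq_top_iff).mp h2
  rw [← Submodule.mem_bot ℂ, ← h3, ← Submodule.iInf_orthogonal, Submodule.mem_iInf]
  exact fun d => (Submodule.mem_orthogonal _ _).mpr (hf d.1 d.2)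

/-- The eigenspace of a value `t` attained at finitely many bidegrees is spanned by the
corresponding harmonics: the component of an eigenvector orthogonal to these is orthogonal to all
harmonics. -/
theorem eigenspace_le_iSup (t : ℝ) (S : Finset (ℕ × ℕ))
    (hS : ∀ d : ℕ × ℕ, kohnEigenvalue n d.1 d.2 = t ↔ d ∈ S) :
    eigenspace (kohnLaplacian n) t ≤ S.sup fun d => harmonics n d.1 d.2 := by
  set U := S.sup fun d => harmonics n d.1 d.2 with hU
  have hfin : FiniteDimensional ℂ U := Submodule.finiteDimensional_finset_sup _ _
  have hUe : U ≤ eigenspace (kohnLaplacian n) t :=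
    Finset.sup_le fun d hd => (hS d).mpr hd ▸ harmonics_le_eigenspace n d.1 d.2
  intro f hf
  have hp : (U.starProjection f : L2 n) ∈ U := Submodule.starProjection_apply_mem U f
  have hz : f - U.starProjection f = 0 := by
    refine eq_zero_of_orthogonal_harmonics fun p q g hg => ?_
    by_cases h : kohnEigenvalue n p q = t
    · have hgU : g ∈ U := (Finset.le_sup (f := fun d : ℕ × ℕ => harmonics n d.1 d.2)
        ((hS (p, q)).mp h)) hg
      exact (Submodule.mem_orthogonal _ _).mp (Submodule.sub_starProjection_mem_orthogonal f) _ hgU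
    · exact inner_eq_zero_of_eigenspace h (harmonics_le_eigenspace n p q hg)
        (Submodule.sub_mem _ hf (hUe hp))
  rw [sub_eq_zero.mp hz]
  exact hp

/-! ### Dimensions of the spaces of harmonics -/

theorem finrank_harmonics_add (n p q : ℕ) :
    Module.finrank ℂ (bihomL2Pred n p q) + Module.finrank ℂ (harmonics n p q)
      = Module.finrank ℂ (bihomL2 n p q) :=
  Submodule.finrank_add_inf_finrank_orthogonal (bihomL2Pred_le n p q)

theorem finrank_harmonics_zero (hn : n ≠ 0) (q : ℕ) :
    Module.finrank ℂ (harmonics n 0 q) = n.multichoose q := by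
  have h := finrank_harmonics_add n 0 q
  have h0 : bihomL2Pred n 0 q = ⊥ := by simp [bihomL2Pred]
  rw [finrank_bihomL2 hn, Nat.multichoose_zero_right, one_mul, h0, finrank_bot, zero_add] at h
  exact h

/-- The dimension is the difference `ab - a'b'` of dimensions of bihomogeneous polynomials, in the
subtraction-free form `(a - a')b + a'(b - b')`. -/
theorem finrank_harmonics_succ (k p q : ℕ) :
    Module.finrank ℂ (harmonics (k + 1) (p + 1) (q + 1))
      = k.multichoose (p + 1) * (k + 1).multichoose (q + 1)
        + (k + 1).multichoose p * k.multichoose (q + 1) := by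
  have h := finrank_harmonics_add (k + 1) (p + 1) (q + 1)
  rw [finrank_bihomL2 k.succ_ne_zero, bihomL2Pred, finrank_bihomL2 k.succ_ne_zero,
    Nat.multichoose_succ_succ k p, Nat.multichoose_succ_succ k q] at h
  rw [Nat.multichoose_succ_succ k q]
  nlinarith

theorem multichoose_succ_le (k p : ℕ) : (k + 1).multichoose p ≤ (p + 1) ^ k := by
  induction k generalizing p with
  | zero => simp
  | succ k ih =>
    induction p with
    | zero => simp
    | succ p ihp =>
      rw [Nat.multichoose_succ_succ]
      calc _ ≤ (p + 1 + 1) ^ k + (p + 1) ^ (k + 1) := add_le_add (ih _) ihp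
        _ ≤ (p + 1 + 1) ^ k + (p + 1 + 1) ^ k * (p + 1) := by
          rw [pow_succ]; gcongr; omega
        _ = _ := by ring

theorem finrank_harmonics_le (k p q : ℕ) :
    Module.finrank ℂ (harmonics (k + 2) p (q + 1))
      ≤ ((p + 1) * (q + 2)) ^ k * ((p + 1) + (q + 2)) := by
  rcases p with _ | p
  · rw [finrank_harmonics_zero (by omega)]
    calc _ ≤ (q + 1 + 1) ^ (k + 1) := multichoose_succ_le _ _
      _ = ((0 + 1) * (q + 2)) ^ k * (q + 2) := by ring
      _ ≤ _ := Nat.mul_le_mul_left _ (by omega)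
  · rw [finrank_harmonics_succ (k + 1)]
    calc _ ≤ (p + 1 + 1) ^ k * (q + 1 + 1) ^ (k + 1) + (p + 1) ^ (k + 1) * (q + 1 + 1) ^ k := by
          gcongr <;> exact multichoose_succ_le _ _
      _ ≤ (p + 1 + 1) ^ k * (q + 1 + 1) ^ (k + 1)
          + (p + 1 + 1) ^ (k + 1) * (q + 1 + 1) ^ k := by gcongr; omega
      _ = _ := by rw [mul_pow]; ring

/-- The harmonics of bidegree `(p, 1)` alone are numerous enough for the lower bound. -/
theorem le_finrank_harmonics_one (k p : ℕ) :
    (k + 2).multichoose p ≤ Module.finrank ℂ (harmonics (k + 2) p 1) := by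
  rcases p with _ | p
  · rw [finrank_harmonics_zero (by omega)]
    simp
  · rw [finrank_harmonics_succ (k + 1), Nat.multichoose_succ_succ]
    simp only [zero_add, Nat.multichoose_one_right]
    nlinarith [Nat.zero_le ((k + 1).multichoose (p + 1)), Nat.zero_le ((k + 2).multichoose p),
      Nat.zero_le ((k + 1).multichoose (p + 1) * k), Nat.zero_le ((k + 2).multichoose p * k)]

theorem sum_range_multichoose (k K : ℕ) :
    ∑ p ∈ Finset.range (K + 1), k.multichoose p = (k + 1).multichoose K := by
  induction K with
  | zero => simp
  | succ K ih => rw [Finset.sum_range_succ, ih, Nat.multichoose_succ_succ, add_comm]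

theorem pow_le_factorial_mul_multichoose (k K : ℕ) :
    (K + 1) ^ k ≤ k.factorial * (k + 1).multichoose K := by
  have h : (k + 1).multichoose K = (K + k).choose k := by
    rw [Nat.multichoose_eq, show k + 1 + K - 1 = k + K by omega, add_comm K k,
      Nat.choose_symm_add]
  rw [h, ← Nat.ascFactorial_eq_factorial_mul_choose]
  exact Nat.pow_succ_le_ascFactorial _ _

theorem sum_range_le_sq (K : ℕ) : ∑ a ∈ Finset.range K, (a + 1) ≤ K ^ 2 := by
  calc ∑ a ∈ Finset.range K, (a + 1) ≤ ∑ a ∈ Finset.range K, K :=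
        Finset.sum_le_sum fun a ha => Finset.mem_range.mp ha
    _ = K ^ 2 := by simp [sq]

theorem sum_inv_sq_le (m : ℕ) : ∑ b ∈ Finset.range m, (1 / ((b : ℝ) + 1) ^ 2) ≤ 2 := by
  -- Telescope with `1 / (m + 2)² ≤ 1 / (m + 1) - 1 / (m + 2)`.
  have h : ∀ m : ℕ, ∑ b ∈ Finset.range (m + 1), (1 / ((b : ℝ) + 1) ^ 2)
      ≤ 2 - 1 / ((m : ℝ) + 1) := by
    intro m
    induction m with
    | zero => norm_num
    | succ m ih =>
      rw [Finset.sum_range_succ]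
      have h1 : 1 / ((m : ℝ) + 1 + 1) ^ 2 ≤ 1 / ((m : ℝ) + 1) - 1 / ((m : ℝ) + 1 + 1) := by
        rw [div_sub_div _ _ (by positivity) (by positivity),
          div_le_div_iff₀ (by positivity) (by positivity)]
        nlinarith [(Nat.cast_nonneg m : (0 : ℝ) ≤ m)]
      push_cast
      linarith
  rcases m with _ | m
  · norm_num
  · exact (h m).trans (sub_le_self _ (by positivity))

/-! ### Counting -/

/-- The pairs `(a - 1, b - 1)` for positive integers `a`, `b` with `a b ≤ m`. -/
def hyperbolaPairs (m : ℕ) : Finset (ℕ × ℕ) :=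
  (Finset.range m ×ˢ Finset.range m).filter fun d => (d.1 + 1) * (d.2 + 1) ≤ m

theorem mem_hyperbolaPairs {m : ℕ} {d : ℕ × ℕ} :
    d ∈ hyperbolaPairs m ↔ (d.1 + 1) * (d.2 + 1) ≤ m := by
  simp only [hyperbolaPairs, Finset.mem_filter, Finset.mem_product, Finset.mem_range,
    and_iff_right_iff_imp]
  intro h
  constructor <;> nlinarith

theorem sum_hyperbolaPairs_fst (m : ℕ) :
    ∑ d ∈ hyperbolaPairs m, ((d.1 : ℝ) + 1) ≤ 2 * (m : ℝ) ^ 2 := by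
  have h1 : ∑ d ∈ hyperbolaPairs m, ((d.1 : ℝ) + 1)
      = ∑ b ∈ Finset.range m, ∑ a ∈ Finset.range (m / (b + 1)), ((a : ℝ) + 1) := by
    rw [Finset.sum_sigma']
    refine Finset.sum_bij' (fun d _ => ⟨d.2, d.1⟩) (fun d _ => (d.2, d.1)) ?_ ?_ ?_ ?_ ?_
    · intro d hd
      have h := mem_hyperbolaPairs.mp hd
      simp only [Finset.mem_sigma, Finset.mem_range]
      refine ⟨by nlinarith, ?_⟩
      exact (Nat.le_div_iff_mul_le (Nat.succ_pos _)).mpr h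
    · rintro ⟨b, a⟩ hd
      simp only [Finset.mem_sigma, Finset.mem_range] at hd
      exact mem_hyperbolaPairs.mpr ((Nat.le_div_iff_mul_le (Nat.succ_pos _)).mp hd.2)
    all_goals simp
  rw [h1]
  calc _ ≤ ∑ b ∈ Finset.range m, (m : ℝ) ^ 2 * (1 / ((b : ℝ) + 1) ^ 2) := by
        refine Finset.sum_le_sum fun b _ => ?_
        have h2 := sum_range_le_sq (m / (b + 1))
        have h3 : ∑ a ∈ Finset.range (m / (b + 1)), ((a : ℝ) + 1)
            ≤ ((m / (b + 1) : ℕ) : ℝ) ^ 2 := by exact_mod_cast h2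
        have h4 : ((m / (b + 1) : ℕ) : ℝ) ≤ (m : ℝ) / ((b : ℝ) + 1) := by
          have := Nat.cast_div_le (α := ℝ) (m := m) (n := b + 1)
          exact_mod_cast this
        calc _ ≤ _ := h3
          _ ≤ ((m : ℝ) / ((b : ℝ) + 1)) ^ 2 := by gcongr
          _ = _ := by rw [div_pow]; ring
    _ ≤ _ := by
        rw [← Finset.mul_sum, mul_comm]
        gcongr
        exact sum_inv_sq_le m

theorem sum_hyperbolaPairs (m : ℕ) :
    ∑ d ∈ hyperbolaPairs m, ((d.1 + 1) + (d.2 + 1)) ≤ 4 * m ^ 2 := by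
  have h : ∑ d ∈ hyperbolaPairs m, ((d.2 : ℝ) + 1) = ∑ d ∈ hyperbolaPairs m, ((d.1 : ℝ) + 1) := by
    refine Finset.sum_bij' (fun d _ => d.swap) (fun d _ => d.swap) ?_ ?_ ?_ ?_ ?_
    · intro d hd
      rw [mem_hyperbolaPairs, mul_comm]
      exact mem_hyperbolaPairs.mp hd
    · intro d hd
      rw [mem_hyperbolaPairs, mul_comm]
      exact mem_hyperbolaPairs.mp hd
    all_goals simp
  have h1 := sum_hyperbolaPairs_fst m
  have h2 : (∑ d ∈ hyperbolaPairs m, (((d.1 : ℝ) + 1) + ((d.2 : ℝ) + 1))) ≤ 4 * (m : ℝ) ^ 2 := by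
    rw [Finset.sum_add_distrib, h]
    linarith
  exact_mod_cast h2

theorem finrank_finset_sup_le {V : Type*} [AddCommGroup V] [Module ℂ V] {ι : Type*}
    (S : Finset ι) (W : ι → Submodule ℂ V) [∀ i, FiniteDimensional ℂ (W i)] :
    Module.finrank ℂ (S.sup W : Submodule ℂ V) ≤ ∑ i ∈ S, Module.finrank ℂ (W i) := by
  classical
  induction S using Finset.induction_on with
  | empty => simp
  | insert a S ha ih =>
    rw [Finset.sup_insert, Finset.sum_insert ha]
    have : FiniteDimensional ℂ (S.sup W : Submodule ℂ V) :=
      Submodule.finiteDimensional_finset_sup _ _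
    exact (Submodule.finrank_add_le_finrank_add_finrank _ _).trans (by gcongr)

theorem kohnEigenvalue_eq (k p q : ℕ) :
    kohnEigenvalue (k + 2) p q = ((2 * q * (p + k + 1) : ℕ) : ℝ) := by
  simp only [kohnEigenvalue]
  push_cast
  ring

theorem multiplicity_eq_of_finiteDimensional {t : ℝ}
    [FiniteDimensional ℂ (eigenspace (kohnLaplacian n) t)] :
    multiplicity n t = Module.finrank ℂ (eigenspace (kohnLaplacian n) t) := by
  rw [multiplicity, ← Module.finrank_eq_rank, map_natCast, ENat.toENNReal_coe]

theorem finrank_harmonics_le_multiplicity (n p q : ℕ) :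
    (Module.finrank ℂ (harmonics n p q) : ℝ≥0∞) ≤ multiplicity n (kohnEigenvalue n p q) := by
  have h : (Module.finrank ℂ (harmonics n p q) : Cardinal)
      ≤ Module.rank ℂ (eigenspace (kohnLaplacian n) (kohnEigenvalue n p q)) := by
    rw [Module.finrank_eq_rank]
    exact Submodule.rank_mono (harmonics_le_eigenspace n p q)
  have h2 := Cardinal.toENat.monotone' h
  change Cardinal.toENat _ ≤ Cardinal.toENat _ at h2
  rw [map_natCast] at h2
  rw [multiplicity, ← ENat.toENNReal_coe]
  exact ENat.toENNReal_le.mpr h2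

theorem multiplicity_le (k : ℕ) {t : ℝ} (ht : 0 < t) :
    multiplicity (k + 2) t ≤ ∑' d : ℕ × ℕ, if kohnEigenvalue (k + 2) d.1 d.2 = t
      then (Module.finrank ℂ (harmonics (k + 2) d.1 d.2) : ℝ≥0∞) else 0 := by
  -- A positive value is attained at finitely many bidegrees only: `0 < 2 q (p + k + 1) = t` bounds
  -- both `p` and `q`.
  have hf : {d : ℕ × ℕ | kohnEigenvalue (k + 2) d.1 d.2 = t}.Finite := by
    obtain ⟨M, hM⟩ := exists_nat_gt t
    refine ((Finset.range M ×ˢ Finset.range M).finite_toSet).subset ?_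
    rintro ⟨p, q⟩ rfl
    simp only [kohnEigenvalue_eq] at hM ht
    have hM' : 2 * q * (p + k + 1) < M := by exact_mod_cast hM
    have ht' : 0 < 2 * q * (p + k + 1) := by exact_mod_cast ht
    have hq : 0 < q := by
      rcases Nat.eq_zero_or_pos q with rfl | h
      · simp at ht'
      · exact h
    simp only [Finset.coe_product, Finset.coe_range, Set.mem_prod, Set.mem_Iio]
    constructor <;> nlinarith
  have hS : ∀ d : ℕ × ℕ, kohnEigenvalue (k + 2) d.1 d.2 = t ↔ d ∈ hf.toFinset := by simp
  have hle := eigenspace_le_iSup t hf.toFinset hS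
  have hfd : FiniteDimensional ℂ
      (hf.toFinset.sup fun d => harmonics (k + 2) d.1 d.2 : Submodule ℂ (L2 (k + 2))) :=
    Submodule.finiteDimensional_finset_sup _ _
  have : FiniteDimensional ℂ (eigenspace (kohnLaplacian (k + 2)) t) :=
    Submodule.finiteDimensional_of_le hle
  rw [multiplicity_eq_of_finiteDimensional]
  calc (Module.finrank ℂ (eigenspace (kohnLaplacian (k + 2)) t) : ℝ≥0∞)
      ≤ ((∑ d ∈ hf.toFinset, Module.finrank ℂ (harmonics (k + 2) d.1 d.2) : ℕ) : ℝ≥0∞) :=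
        Nat.cast_le.mpr ((Submodule.finrank_mono hle).trans
          (finrank_finset_sup_le hf.toFinset fun d : ℕ × ℕ => harmonics (k + 2) d.1 d.2))
    _ = ∑ d ∈ hf.toFinset, if kohnEigenvalue (k + 2) d.1 d.2 = t
      then (Module.finrank ℂ (harmonics (k + 2) d.1 d.2) : ℝ≥0∞) else 0 := by
        rw [Nat.cast_sum]
        exact Finset.sum_congr rfl fun d hd => (if_pos ((hS d).mpr hd)).symm
    _ ≤ _ := ENNReal.sum_le_tsum _

theorem eigenvalueCount_le_tsum (k : ℕ) (m : ℤ) :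
    eigenvalueCount (k + 2) m ≤ ∑' d : ℕ × ℕ,
      if kohnEigenvalue (k + 2) d.1 d.2 ∈ Set.Ioc (0 : ℝ) m
      then (Module.finrank ℂ (harmonics (k + 2) d.1 d.2) : ℝ≥0∞) else 0 := by
  rw [eigenvalueCount]
  refine (ENNReal.tsum_le_tsum fun t => multiplicity_le k t.2.1).trans ?_
  rw [ENNReal.tsum_comm]
  refine ENNReal.tsum_le_tsum fun d => ?_
  by_cases h : kohnEigenvalue (k + 2) d.1 d.2 ∈ Set.Ioc (0 : ℝ) m
  · rw [if_pos h, tsum_eq_single ⟨_, h⟩]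
    · simp
    · intro t ht
      exact if_neg fun e => ht (Subtype.ext e.symm)
  · refine le_of_eq_of_le (ENNReal.tsum_eq_zero.mpr fun t => ?_) zero_le
    exact if_neg (fun e : kohnEigenvalue (k + 2) d.1 d.2 = t => h (e ▸ t.2))

/-- A bidegree `(p, q)` with eigenvalue in `(0, m]` satisfies `(p + 1)(q + 1) ≤ m`, so the dimension
of its harmonics is at most `m ^ (n - 2) ((p + 1) + (q + 1))`; the second factor sums to at most
`4 m²`. -/
theorem eigenvalueCount_le (k m : ℕ) :
    eigenvalueCount (k + 2) (m : ℤ) ≤ ((4 * m ^ (k + 2) : ℕ) : ℝ≥0∞) := by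
  refine (eigenvalueCount_le_tsum k m).trans ?_
  calc _ ≤ ∑' d : ℕ × ℕ, if d ∈ hyperbolaPairs m
        then ((m ^ k * ((d.1 + 1) + (d.2 + 1)) : ℕ) : ℝ≥0∞) else 0 := by
        refine ENNReal.tsum_le_tsum fun d => ?_
        obtain ⟨p, q⟩ := d
        by_cases h : kohnEigenvalue (k + 2) p q ∈ Set.Ioc (0 : ℝ) ((m : ℤ) : ℝ)
        swap
        · simp only [if_neg h, zero_le]
        simp only [if_pos h]
        rw [kohnEigenvalue_eq, Int.cast_natCast, Set.mem_Ioc] at h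
        have h1 : 0 < 2 * q * (p + k + 1) := by exact_mod_cast h.1
        have h2 : 2 * q * (p + k + 1) ≤ m := by exact_mod_cast h.2
        rcases q with _ | q
        · simp at h1
        have h3 : (p + 1) * (q + 2) ≤ m := by nlinarith [Nat.zero_le (q * k), Nat.zero_le (q * p)]
        rw [if_pos (mem_hyperbolaPairs.mpr h3), Nat.cast_le]
        calc _ ≤ ((p + 1) * (q + 2)) ^ k * ((p + 1) + (q + 2)) := finrank_harmonics_le k p q
          _ ≤ m ^ k * ((p + 1) + (q + 2)) := by gcongr
          _ = _ := rfl
    _ = ∑ d ∈ hyperbolaPairs m, ((m ^ k * ((d.1 + 1) + (d.2 + 1)) : ℕ) : ℝ≥0∞) := by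
        rw [tsum_eq_sum (s := hyperbolaPairs m) fun d hd => if_neg hd]
        exact Finset.sum_congr rfl fun d hd => if_pos hd
    _ ≤ _ := by
        rw [← Nat.cast_sum, Nat.cast_le, ← Finset.mul_sum]
        calc _ ≤ m ^ k * (4 * m ^ 2) := by gcongr; exact sum_hyperbolaPairs m
          _ = _ := by ring

/-- The bidegrees `(p, 1)` with `p ≤ K` have distinct eigenvalues `2 (p + n - 1)`. -/
theorem sum_multichoose_le_eigenvalueCount (k K : ℕ) (m : ℤ)
    (hm : ((2 * (K + k + 1) : ℕ) : ℤ) ≤ m) :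
    (((k + 3).multichoose K : ℕ) : ℝ≥0∞) ≤ eigenvalueCount (k + 2) m := by
  have hmem : ∀ p : Fin (K + 1), kohnEigenvalue (k + 2) p 1 ∈ Set.Ioc (0 : ℝ) m := by
    intro p
    have hp : 2 * 1 * ((p : ℕ) + k + 1) ≤ 2 * (K + k + 1) := by have := p.2; omega
    rw [kohnEigenvalue_eq]
    refine ⟨by positivity, ?_⟩
    have : ((2 * 1 * ((p : ℕ) + k + 1) : ℕ) : ℤ) ≤ m := le_trans (by exact_mod_cast hp) hm
    exact_mod_cast this
  set e : Fin (K + 1) → Set.Ioc (0 : ℝ) m := fun p => ⟨_, hmem p⟩ with he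
  have hinj : Function.Injective e := by
    intro p p' h
    have h' : kohnEigenvalue (k + 2) p 1 = kohnEigenvalue (k + 2) p' 1 := congrArg Subtype.val h
    rw [kohnEigenvalue_eq, kohnEigenvalue_eq, Nat.cast_inj] at h'
    exact Fin.ext (by omega)
  calc (((k + 3).multichoose K : ℕ) : ℝ≥0∞)
      = ∑ p : Fin (K + 1), ((k + 2).multichoose (p : ℕ) : ℝ≥0∞) := by
        rw [← sum_range_multichoose, Nat.cast_sum,
          Finset.sum_range fun p => ((k + 2).multichoose p : ℝ≥0∞)]
    _ ≤ ∑ p : Fin (K + 1), multiplicity (k + 2) (e p) :=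
        Finset.sum_le_sum fun p _ => (Nat.cast_le.mpr (le_finrank_harmonics_one k p)).trans
          (finrank_harmonics_le_multiplicity _ _ _)
    _ = ∑' p : Fin (K + 1), multiplicity (k + 2) (e p) := (tsum_fintype _).symm
    _ ≤ _ := ENNReal.tsum_comp_le_tsum_of_injective hinj fun t => multiplicity (k + 2) t

theorem pow_le_eigenvalueCount (k m : ℕ) (hm : 4 * (k + 1) ≤ m) :
    ((m ^ (k + 2) : ℕ) : ℝ≥0∞)
      ≤ ((4 ^ (k + 2) * (k + 2).factorial : ℕ) : ℝ≥0∞) * eigenvalueCount (k + 2) (m : ℤ) := by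
  -- `K = m / 2 - (n - 1)` is the largest `p` for which the eigenvalue of bidegree `(p, 1)` is at
  -- most `m`.
  obtain ⟨K, hK⟩ : ∃ K, K + 1 + k = m / 2 := ⟨m / 2 - 1 - k, by omega⟩
  have h := sum_multichoose_le_eigenvalueCount k K m (by exact_mod_cast (by omega))
  have h1 : m ≤ 4 * (K + 1) := by omega
  calc ((m ^ (k + 2) : ℕ) : ℝ≥0∞)
      ≤ ((4 ^ (k + 2) * (k + 2).factorial * (k + 3).multichoose K : ℕ) : ℝ≥0∞) := by
        rw [Nat.cast_le]
        calc m ^ (k + 2) ≤ (4 * (K + 1)) ^ (k + 2) := by gcongr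
          _ = 4 ^ (k + 2) * (K + 1) ^ (k + 2) := mul_pow _ _ _
          _ ≤ 4 ^ (k + 2) * ((k + 2).factorial * (k + 3).multichoose K) := by
            gcongr
            exact pow_le_factorial_mul_multichoose _ _
          _ = _ := by ring
    _ ≤ _ := by
        rw [Nat.cast_mul]
        gcongr

end KohnSphere

theorem theorem1p4 (n : ℕ) (hn : 2 ≤ n) :
    ∃ c : ℝ, 0 < c ∧
      (∀ m : ℤ, 0 ≤ m →
        KohnSphere.eigenvalueCount n m ≤ ENNReal.ofReal (c * (m : ℝ) ^ n)) ∧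
      (∀ᶠ m : ℤ in Filter.atTop,
        ENNReal.ofReal (1 / c * (m : ℝ) ^ n) ≤ KohnSphere.eigenvalueCount n m) := by
  obtain ⟨k, rfl⟩ : ∃ k, n = k + 2 := ⟨n - 2, by omega⟩
  have hc : 4 ≤ 4 ^ (k + 2) * (k + 2).factorial := by
    have h1 := (k + 2).factorial_pos
    have h2 : 4 ^ 1 ≤ 4 ^ (k + 2) := Nat.pow_le_pow_right (by norm_num) (by omega)
    nlinarith
  -- The upper bound holds with constant `4`; the lower one needs `4 ^ n * n!`.
  set c : ℕ := 4 ^ (k + 2) * (k + 2).factorial with hcdef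
  have hc0 : 0 < (c : ℝ) := by exact_mod_cast (by omega : 0 < c)
  refine ⟨c, hc0, ?_, ?_⟩
  · intro m hm
    obtain ⟨m, rfl⟩ := Int.eq_ofNat_of_zero_le hm
    refine (KohnSphere.eigenvalueCount_le k m).trans ?_
    have : ENNReal.ofReal ((c : ℝ) * ((m : ℤ) : ℝ) ^ (k + 2)) = ((c * m ^ (k + 2) : ℕ) : ℝ≥0∞) := by
      rw [← ENNReal.ofReal_natCast]
      push_cast
      rfl
    rw [this, Nat.cast_le]
    gcongr
  · filter_upwards [Filter.eventually_ge_atTop ((4 * (k + 1) : ℕ) : ℤ)] with m hm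
    obtain ⟨m, rfl⟩ := Int.eq_ofNat_of_zero_le (le_trans (by positivity) hm)
    have h := KohnSphere.pow_le_eigenvalueCount k m (by exact_mod_cast hm)
    have : ENNReal.ofReal (1 / (c : ℝ) * ((m : ℤ) : ℝ) ^ (k + 2))
        = ((m ^ (k + 2) : ℕ) : ℝ≥0∞) / (c : ℝ≥0∞) := by
      rw [one_div_mul_eq_div, ENNReal.ofReal_div_of_pos hc0, ENNReal.ofReal_natCast,
        ← ENNReal.ofReal_natCast (m ^ (k + 2))]
      push_cast
      rfl
    rw [this]
    refine ENNReal.div_le_of_le_mul ?_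
    rw [mul_comm]
    exact h
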